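/- Let $f:\mathbb{R}^2\to\mathbb{R}^2$ be $C^\infty$, let $0<|\lambda|<1<|\sigma|$ with $\lambda\sigma=1$, and let $A,B:\mathbb{R}\to\mathbb{R}$ be $C^\infty$; put $a_1=A(0)$, $b_1=B(0)$. Let $\mathcal{N}\subset\mathbb{R}^2$ be a bounded convex neighbourhood of the origin on which $$f(x,y)=T_0(x,y)=\Big(\lambda x\,(1+xyA(xy)),\ \tfrac1\lambda\, y\,(1+xyB(xy))\Big).$$ Let $x^*,y^*>0$ be such that $(x^*,0),(\lambda x^*,0),(0,y^*/\sigma),(0,y^*/\sigma^2)\in\mathcal{N}$, and suppose $f^m(0,y^*)=(x^*,0)$ for some $m\ge 1$. Write $d_1$, $d_2$, $d_5$ for the coefficients of $x$, $y-y^*$ and $(y-y^*)^2$ in the Taylor expansion of the second component of $f^m$ at $(0,y^*)$, and assume $d_1=y^*/x^*$, $d_2=0$ and $d_5\neq 0$. For $\eta>0$ let $\mathcal{N}_\eta=\{(x,y)\in\mathcal{N}: |xy|<\eta\}$. An $\mathrm{SR}_k$-solution is a sequence $p_j=f^j(p_0)$ with $f^{k+m}(p_0)=p_0$ and $p_0,\dots,p_{k-1}\in\mathcal{N}_\eta$.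 Let $\tau_k$ be the trace of $\mathrm{D}f^{k+m}(p_k)$, and call the solution stable if it is Lyapunov stable. Let $\Gamma=\{(0,y^*/\sigma^j):j\ge0\}\cup\{f^j(0,y^*):j\ge 0\}$ be the homoclinic orbit. Then there exists $\eta>0$ with the following property. Let $K\subseteq\{1,2,\dots\}$ be infinite and suppose that for each $k\in K$ an $\mathrm{SR}_k$-solution $(p^{(k)}_j)_{j\ge0}$ is given, such that $p^{(k)}_0\to(x^*,0)$ as $k\to\infty$ in $K$. Suppose moreover that either $(0,y^*)$ is the only point that $f^m$ maps to $(x^*,0)$ (for instance, $f$ is injective), or the solutions approach the homoclinic orbit, that is, $\sup_j\operatorname{dist}(p^{(k)}_j,\Gamma)\to0$ as $k\to\infty$ in $K$. Then: 1. if the $\mathrm{SR}_k$-solution is stable for every $k\in K$, then $a_1+b_1=0$; 2. if $a_1+b_1\ne0$ (whether or not the solutions are stable), then there is $\zeta\neq0$ with $d_5\zeta^2=-(a_1+b_1)x^*(y^*)^2$, and $|\tau_k|/\sqrt{k}\to 2|d_5\zeta|$ as $k\to\infty$ in $K$. -/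

import Mathlib

open Filter Topology
open scoped ContDiff

/-- The resonant normal form `(x, y) ↦ (lam x (1 + x y A(xy)), lam⁻¹ y (1 + x y B(xy)))`. -/
noncomputable def resonantNormalForm (lam : ℝ) (A B : ℝ → ℝ) (p : ℝ × ℝ) : ℝ × ℝ :=
  (lam * p.1 * (1 + p.1 * p.2 * A (p.1 * p.2)),
    1 / lam * p.2 * (1 + p.1 * p.2 * B (p.1 * p.2)))

/-- The set of points `(x, y)` of `N` with `|x y| < η`. -/
def hyperbolicNbhd (N : Set (ℝ × ℝ)) (η : ℝ) : Set (ℝ × ℝ) :=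
  {p | p ∈ N ∧ |p.1 * p.2| < η}

/-- `z` is the initial point of an `SR_k`-solution of `f`: a solution `z, f z, f (f z), …` of
period `k + m` whose points with indices `0, …, k - 1` lie in `hyperbolicNbhd N η`.
(The period `k + m` is not required to be the least one.) -/
def IsSRSolution (f : ℝ × ℝ → ℝ × ℝ) (m : ℕ) (N : Set (ℝ × ℝ)) (η : ℝ) (k : ℕ)
    (z : ℝ × ℝ) : Prop :=
  Function.IsPeriodicPt f (k + m) z ∧ ∀ j < k, f^[j] z ∈ hyperbolicNbhd N η

/-- Lyapunov stability of the forward solution of `f` starting at `z`. -/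
def IsLyapunovStable (f : ℝ × ℝ → ℝ × ℝ) (z : ℝ × ℝ) : Prop :=
  ∀ ε > 0, ∃ δ > 0, ∀ w, dist w z < δ → ∀ n : ℕ, dist (f^[n] w) (f^[n] z) < ε

/-- The trace `τ_k` of the derivative of the return map `f^(k+m)` at the point with index `k`
of the solution starting at `z`. -/
noncomputable def returnTrace (f : ℝ × ℝ → ℝ × ℝ) (m k : ℕ) (z : ℝ × ℝ) : ℝ :=
  LinearMap.trace ℝ (ℝ × ℝ) (fderiv ℝ (f^[k + m]) (f^[k] z) : ℝ × ℝ →ₗ[ℝ] ℝ × ℝ)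

/-- The coefficient of `x` in the Taylor expansion at `(0, ys)` of the second component of
`f^m`. -/
noncomputable def coeffD1 (f : ℝ × ℝ → ℝ × ℝ) (m : ℕ) (ys : ℝ) : ℝ :=
  deriv (fun x : ℝ => (f^[m] (x, ys)).2) 0

/-- The coefficient of `y - ys` in the Taylor expansion at `(0, ys)` of the second component of
`f^m`. -/
noncomputable def coeffD2 (f : ℝ × ℝ → ℝ × ℝ) (m : ℕ) (ys : ℝ) : ℝ :=
  deriv (fun y : ℝ => (f^[m] (0, y)).2) ys

/-- The coefficient of `(y - ys)^2` in the Taylor expansion at `(0, ys)` of the second component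
of `f^m`. -/
noncomputable def coeffD5 (f : ℝ × ℝ → ℝ × ℝ) (m : ℕ) (ys : ℝ) : ℝ :=
  iteratedDeriv 2 (fun y : ℝ => (f^[m] (0, y)).2) ys / 2

/-- The homoclinic orbit through `(0, ys)`: the backward orbit `(0, ys / sig ^ j)` along the
unstable manifold, together with the forward orbit of `(0, ys)`. -/
def homoclinicOrbit (f : ℝ × ℝ → ℝ × ℝ) (sig ys : ℝ) : Set (ℝ × ℝ) :=
  {q | ∃ j : ℕ, q = (0, ys / sig ^ j) ∨ q = f^[j] (0, ys)}

/-- The solutions starting at the points `z k`, `k ∈ K`, approach the set `S` as `k → ∞`: the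
distance from a point of the solution to `S` tends to zero, uniformly over the solution. -/
def SolutionsApproach (f : ℝ × ℝ → ℝ × ℝ) (K : Set ℕ) (z : ℕ → ℝ × ℝ)
    (S : Set (ℝ × ℝ)) : Prop :=
  ∀ ε > 0, ∃ k₀ : ℕ, ∀ k ∈ K, k₀ ≤ k → ∀ j : ℕ, ∃ q ∈ S, dist (f^[j] (z k)) q < ε

/-! Write `p k` for the starting point near `(xs, 0)`, `q k` for its image after `k` steps, and `F =
f^[m]`. The quantity `h = x y` evolves autonomously under the normal form, so `q k` is `p k` with
its coordinates multiplied by `lam ^ k * prodA` and `lam⁻¹ ^ k * prodB`, where both products run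
along the orbit of `h`. Contraction in `x` forwards and in `y` backwards makes `h` exponentially
small in `k` along the whole passage; hence `h ~ lam ^ k * xs * ys` uniformly, and `prodA`, `prodB`
are `1 + k * lam ^ k * xs * ys * A 0` and the same with `B 0`, up to `o(k * lam ^ k)`.

Insert this into the second component of `F (q k) = p k`. Since `d₁ = ys / xs`, the terms of order
`lam ^ k` cancel. At order `k * lam ^ (2 * k)` what is left is `d₅ * (q₂ - ys) ^ 2 ≈ -(A 0 + B 0) *
xs * ys ^ 2 * k * lam ^ (2 * k)`. So the deviation `q₂ - ys`, in units of `√k * lam ^ k`, has a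
square that converges (`tendsto_scaledDev_sq`), to `ζ ^ 2` with `ζ ≠ 0` when `A 0 + B 0 ≠ 0`.

In the trace of the return map the expanding entry, about `lam⁻¹ ^ k`, multiplies `∂F₂/∂y ≈ 2 * d₅ *
(q₂ - ys)`, while all other contributions are `o(√k)`; this gives the growth `2 * |d₅ * ζ| * √k`
(`tendsto_abs_trace_div`). The determinant stays bounded, so for large `k` the trace dominates it
and the solution is unstable (`not_isLyapunovStable_of_trace`).

The convergence `q k → (0, ys)` comes from compactness: every cluster point is mapped to `(xs, 0)`
by `F`, and either alternative in the hypotheses leaves only `(0, ys)`. -/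

/-! ### Planar linear algebra and an instability criterion -/

theorem prod_eq_smul_add_smul (v : ℝ × ℝ) :
    v = v.1 • ((1 : ℝ), (0 : ℝ)) + v.2 • ((0 : ℝ), (1 : ℝ)) := by
  ext <;> simp

theorem clm_prod_apply (L : ℝ × ℝ →L[ℝ] ℝ × ℝ) (v : ℝ × ℝ) :
    L v = (v.1 * (L (1, 0)).1 + v.2 * (L (0, 1)).1, v.1 * (L (1, 0)).2 + v.2 * (L (0, 1)).2) := by
  conv_lhs => rw [prod_eq_smul_add_smul v, map_add, map_smul, map_smul]
  ext <;> simp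

/-- The trace of a linear map of the plane, in terms of its entries. -/
theorem trace_prod_eq (L : ℝ × ℝ →L[ℝ] ℝ × ℝ) :
    LinearMap.trace ℝ (ℝ × ℝ) (L : ℝ × ℝ →ₗ[ℝ] ℝ × ℝ) = (L (1, 0)).1 + (L (0, 1)).2 := by
  rw [LinearMap.trace_eq_matrix_trace ℝ (Module.Basis.finTwoProd ℝ), Matrix.trace_fin_two]
  simp [LinearMap.toMatrix_apply]

/-- The determinant of a linear map of the plane, in terms of its entries. -/
def entryDet (L : ℝ × ℝ →L[ℝ] ℝ × ℝ) : ℝ :=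
  (L (1, 0)).1 * (L (0, 1)).2 - (L (0, 1)).1 * (L (1, 0)).2

theorem entryDet_comp (L M : ℝ × ℝ →L[ℝ] ℝ × ℝ) :
    entryDet (L.comp M) = entryDet L * entryDet M := by
  simp only [entryDet, ContinuousLinearMap.comp_apply]
  rw [clm_prod_apply L (M (1, 0)), clm_prod_apply L (M (0, 1))]
  ring

/-- The four-term form is symmetric in the two factors, which makes the cyclicity of the trace
visible. -/
theorem entryTrace_comp (L M : ℝ × ℝ →L[ℝ] ℝ × ℝ) :
    (L.comp M (1, 0)).1 + (L.comp M (0, 1)).2 =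
      (L (1, 0)).1 * (M (1, 0)).1 + (L (0, 1)).1 * (M (1, 0)).2 +
        (L (1, 0)).2 * (M (0, 1)).1 + (L (0, 1)).2 * (M (0, 1)).2 := by
  simp only [ContinuousLinearMap.comp_apply]
  rw [clm_prod_apply L (M (1, 0)), clm_prod_apply L (M (0, 1))]
  ring

/-- The Cayley–Hamilton identity in the plane. -/
theorem clm_prod_apply_apply (L : ℝ × ℝ →L[ℝ] ℝ × ℝ) (v : ℝ × ℝ) :
    L (L v) = ((L (1, 0)).1 + (L (0, 1)).2) • L v - entryDet L • v := by
  rw [clm_prod_apply L (L v), clm_prod_apply L v]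
  ext <;> simp [entryDet] <;> ring

theorem IsLyapunovStable.iterate {f : ℝ × ℝ → ℝ × ℝ} {z : ℝ × ℝ} (h : IsLyapunovStable f z)
    (n : ℕ) : IsLyapunovStable (f^[n]) z := by
  intro ε hε
  obtain ⟨δ, hδ, H⟩ := h ε hε
  refine ⟨δ, hδ, fun w hw j => ?_⟩
  rw [← Function.iterate_mul]
  exact H w hw _

/-- A fixed point of a planar map is unstable when the trace of the linearization is large in
comparison with its determinant. -/
theorem not_isLyapunovStable_of_trace {g : ℝ × ℝ → ℝ × ℝ} {p : ℝ × ℝ}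
    {L : ℝ × ℝ →L[ℝ] ℝ × ℝ} (hL : HasFDerivAt g L p) (hp : g p = p)
    (hbig : |entryDet L| + 3 ≤ |(L (1, 0)).1 + (L (0, 1)).2|) : ¬ IsLyapunovStable g p := by
  intro hst
  set τ := (L (1, 0)).1 + (L (0, 1)).2 with hτ
  set d := entryDet L with hd
  have hCpos : 0 < |τ| + ‖L‖ + 1 := by positivity
  -- This `ε` makes the three nonlinear error terms in the two-step recursion add up to at most `‖e
  -- (n + 1)‖ / 2`.
  set ε : ℝ := 1 / (2 * (|τ| + ‖L‖ + 1)) with hε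
  have hεpos : 0 < ε := by positivity
  have hεC : ε * (|τ| + ‖L‖ + 1) = 1 / 2 := by rw [hε]; field_simp
  have hε1 : ε ≤ 1 / 2 := by
    rw [← hεC]
    have : (1 : ℝ) ≤ |τ| + ‖L‖ + 1 := by
      have := abs_nonneg τ; have := norm_nonneg L; linarith
    nlinarith
  have hev := hL.isLittleO.def hεpos
  obtain ⟨R, hR, hball⟩ := Metric.eventually_nhds_iff.1 hev
  obtain ⟨δ, hδ, hstab⟩ := hst R hR
  have hfix : ∀ n, g^[n] p = p := fun n => Function.iterate_fixed hp n
  -- No eigenvector is needed: a trace of modulus at least 3 has a diagonal entry of modulus at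
  -- least 3/2, so a basis vector will do.
  obtain ⟨v, hv1, hLv⟩ : ∃ v : ℝ × ℝ, ‖v‖ = 1 ∧ 3 / 2 ≤ ‖L v‖ := by
    by_contra! hcon
    have h1 := hcon (1, 0) (by simp)
    have h2 := hcon (0, 1) (by simp)
    have h3 := (norm_fst_le (L (1, 0))).trans_lt h1
    have h4 := (norm_snd_le (L (0, 1))).trans_lt h2
    have h5 := abs_add_le (L (1, 0)).1 (L (0, 1)).2
    rw [Real.norm_eq_abs] at h3 h4
    have := abs_nonneg d
    linarith
  set t : ℝ := δ / 2 with ht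
  have htpos : 0 < t := by positivity
  set w : ℝ × ℝ := p + t • v with hw
  have hwd : dist w p < δ := by
    rw [dist_eq_norm, hw, add_sub_cancel_left, norm_smul, hv1, Real.norm_eq_abs, abs_of_pos htpos]
    linarith
  set e : ℕ → ℝ × ℝ := fun n => g^[n] w - p with he
  have heR : ∀ n, ‖e n‖ < R := by
    intro n
    have := hstab w hwd n
    rwa [hfix, dist_eq_norm] at this
  have hstep : ∀ n, ‖e (n + 1) - L (e n)‖ ≤ ε * ‖e n‖ := by
    intro n
    have := hball (y := g^[n] w) (by rw [dist_eq_norm]; exact heR n)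
    rw [hp] at this
    simpa only [he, Function.iterate_succ_apply'] using this
  have he0 : e 0 = t • v := by simp [he, hw]
  have hn0 : ‖e 0‖ = t := by
    rw [he0, norm_smul, hv1, Real.norm_eq_abs, abs_of_pos htpos, mul_one]
  have h01 : ‖e 0‖ ≤ ‖e 1‖ := by
    have h1 := hstep 0
    have h2 : ‖L (e 0)‖ = t * ‖L v‖ := by
      rw [he0, map_smul, norm_smul, Real.norm_eq_abs, abs_of_pos htpos]
    have h3 : ‖L (e 0)‖ ≤ ‖e 1‖ + ‖e 1 - L (e 0)‖ := by
      have := norm_sub_le (e 1) (e 1 - L (e 0))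
      simpa using this
    rw [zero_add, hn0] at h1
    rw [hn0]
    nlinarith
  have hgrow : ∀ n, ‖e n‖ ≤ ‖e (n + 1)‖ → 2 * ‖e (n + 1)‖ ≤ ‖e (n + 2)‖ := by
    intro n hn
    set r0 := e (n + 1) - L (e n) with hr0
    set r1 := e (n + 2) - L (e (n + 1)) with hr1
    have hr0b : ‖r0‖ ≤ ε * ‖e (n + 1)‖ := (hstep n).trans (by gcongr)
    have hr1b : ‖r1‖ ≤ ε * ‖e (n + 1)‖ := hstep (n + 1)
    have hLe : L (e n) = e (n + 1) - r0 := by rw [hr0]; abel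
    -- Cayley–Hamilton turns the orbit into a perturbed recursion `e (n + 2) ≈ τ • e (n + 1) - d • e
    -- n`; as `|τ|` exceeds `|d|` by 3, norms that do not decrease once must double from then on.
    have key : τ • e (n + 1) = e (n + 2) + (d • e n + τ • r0 - L r0 - r1) := by
      have h1 : L (L (e n)) = τ • L (e n) - d • e n := clm_prod_apply_apply L (e n)
      have h2 : L (e (n + 1)) = e (n + 2) - r1 := by rw [hr1]; abel
      have h3 : e (n + 2) - r1 - L r0 = τ • e (n + 1) - τ • r0 - d • e n := by
        rw [← h2, ← smul_sub, ← hLe, ← h1, ← map_sub, ← hLe]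
      have h4 : τ • e (n + 1) = (τ • e (n + 1) - τ • r0 - d • e n) + τ • r0 + d • e n := by abel
      rw [h4, ← h3]; abel
    have h5 : ‖τ • e (n + 1)‖ = |τ| * ‖e (n + 1)‖ := by rw [norm_smul, Real.norm_eq_abs]
    have h6 : ‖d • e n‖ ≤ |d| * ‖e (n + 1)‖ := by
      rw [norm_smul, Real.norm_eq_abs]; gcongr
    have h7 : ‖τ • r0‖ ≤ |τ| * (ε * ‖e (n + 1)‖) := by
      rw [norm_smul, Real.norm_eq_abs]; gcongr
    have h8 : ‖L r0‖ ≤ ‖L‖ * (ε * ‖e (n + 1)‖) := (L.le_opNorm r0).trans (by gcongr)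
    have h9 : ‖τ • e (n + 1)‖ ≤ ‖e (n + 2)‖ + (‖d • e n‖ + ‖τ • r0‖ + ‖L r0‖ + ‖r1‖) := by
      rw [key]
      refine (norm_add_le _ _).trans ?_
      gcongr
      refine (norm_sub_le _ _).trans ?_
      gcongr
      refine (norm_sub_le _ _).trans ?_
      gcongr
      exact norm_add_le _ _
    have h10 : |τ| * ‖e (n + 1)‖ ≤
        ‖e (n + 2)‖ + (|d| * ‖e (n + 1)‖ + (ε * (|τ| + ‖L‖ + 1)) * ‖e (n + 1)‖) := by
      rw [← h5]; linarith
    rw [hεC] at h10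
    have h11 : (|d| + 3) * ‖e (n + 1)‖ ≤ |τ| * ‖e (n + 1)‖ := by gcongr
    have := norm_nonneg (e (n + 1))
    linarith
  have hmono : ∀ n, ‖e n‖ ≤ ‖e (n + 1)‖ := by
    intro n
    induction n with
    | zero => exact h01
    | succ n ih =>
      have := hgrow n ih
      have := norm_nonneg (e (n + 1))
      show ‖e (n + 1)‖ ≤ ‖e (n + 2)‖
      linarith
  have hpow : ∀ n, 2 ^ n * t ≤ ‖e (n + 1)‖ := by
    intro n
    induction n with
    | zero => rw [pow_zero, one_mul, ← hn0]; exact h01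
    | succ n ih =>
      have := hgrow n (hmono n)
      rw [pow_succ]
      linarith
  obtain ⟨n, hn⟩ := pow_unbounded_of_one_lt (R / t) (one_lt_two)
  rw [div_lt_iff₀ htpos] at hn
  linarith [hpow n, heR (n + 1)]

/-! ### Iterates of the resonant normal form and their derivatives -/

theorem contDiff_iterate_endo {E : Type*} [NormedAddCommGroup E] [NormedSpace ℝ E] {f : E → E}
    (hf : ContDiff ℝ ∞ f) (n : ℕ) : ContDiff ℝ ∞ (f^[n]) := by
  induction n with
  | zero => exact contDiff_id
  | succ n ih => exact ih.comp hf

/-- The factor `1 + h A(h)` of the resonant normal form. -/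
noncomputable def resFactor (A : ℝ → ℝ) (h : ℝ) : ℝ := 1 + h * A h

/-- The map induced by the resonant normal form on the product `h = x y`. -/
noncomputable def resProduct (A B : ℝ → ℝ) (h : ℝ) : ℝ := h * resFactor A h * resFactor B h

/-- The product of `a` along the first `j` points of the orbit of `h` under `g`. -/
noncomputable def orbitProd (a g : ℝ → ℝ) (j : ℕ) (h : ℝ) : ℝ :=
  ∏ i ∈ Finset.range j, a (g^[i] h)

/-- The logarithmic derivative of `orbitProd a g j`. -/
noncomputable def orbitLogDeriv (a g : ℝ → ℝ) (j : ℕ) (h : ℝ) : ℝ :=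
  ∑ i ∈ Finset.range j, deriv a (g^[i] h) * orbitProd (deriv g) g i h / a (g^[i] h)

theorem orbitProd_succ (a g : ℝ → ℝ) (j : ℕ) (h : ℝ) :
    orbitProd a g (j + 1) h = orbitProd a g j h * a (g^[j] h) := by
  rw [orbitProd, Finset.prod_range_succ, orbitProd]

theorem hasDerivAt_iterate_orbitProd {g : ℝ → ℝ} (hg : Differentiable ℝ g) (j : ℕ) (h : ℝ) :
    HasDerivAt (g^[j]) (orbitProd (deriv g) g j h) h := by
  induction j with
  | zero => simpa [orbitProd] using hasDerivAt_id h
  | succ j ih =>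
    rw [Function.iterate_succ', orbitProd_succ, mul_comm]
    exact (hg _).hasDerivAt.comp h ih

theorem hasDerivAt_orbitProd {a g : ℝ → ℝ} (ha : Differentiable ℝ a) (hg : Differentiable ℝ g)
    (j : ℕ) (h : ℝ) (h0 : ∀ i < j, a (g^[i] h) ≠ 0) :
    HasDerivAt (orbitProd a g j) (orbitProd a g j h * orbitLogDeriv a g j h) h := by
  induction j with
  | zero =>
    have h1 : orbitProd a g 0 = fun _ => 1 := by funext t; simp [orbitProd]
    rw [h1]
    simpa [orbitLogDeriv] using hasDerivAt_const h (1 : ℝ)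
  | succ j ih =>
    have h1 := ih fun i hi => h0 i (hi.trans (Nat.lt_succ_self j))
    have h2 := (ha (g^[j] h)).hasDerivAt.comp h (hasDerivAt_iterate_orbitProd hg j h)
    have h3 : orbitProd a g (j + 1) = fun t => orbitProd a g j t * (a ∘ g^[j]) t :=
      funext fun t => orbitProd_succ a g j t
    have h4 := h0 j (Nat.lt_succ_self j)
    rw [h3]
    refine (h1.mul h2).congr_deriv ?_
    rw [orbitLogDeriv, orbitLogDeriv, Finset.sum_range_succ]
    simp only [Function.comp_apply]
    field_simp

theorem resonantNormalForm_eq (lam : ℝ) (A B : ℝ → ℝ) (p : ℝ × ℝ) :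
    resonantNormalForm lam A B p =
      (lam * p.1 * resFactor A (p.1 * p.2), 1 / lam * p.2 * resFactor B (p.1 * p.2)) := rfl

/-- The linear multipliers cancel in `x y`, which therefore follows the one-dimensional map
`resProduct`; each coordinate only collects factors along that orbit. -/
theorem iterate_resonantNormalForm {lam : ℝ} (hlam : lam ≠ 0) (A B : ℝ → ℝ) (j : ℕ)
    (x y : ℝ) :
    (resonantNormalForm lam A B)^[j] (x, y) =
      (lam ^ j * x * orbitProd (resFactor A) (resProduct A B) j (x * y),
        (1 / lam) ^ j * y * orbitProd (resFactor B) (resProduct A B) j (x * y)) ∧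
    ((resonantNormalForm lam A B)^[j] (x, y)).1 * ((resonantNormalForm lam A B)^[j] (x, y)).2 =
      (resProduct A B)^[j] (x * y) := by
  induction j with
  | zero => simp [orbitProd]
  | succ j ih =>
    obtain ⟨h1, h2⟩ := ih
    rw [Function.iterate_succ_apply', Function.iterate_succ_apply', resonantNormalForm_eq, h2]
    refine ⟨?_, ?_⟩
    · rw [h1, orbitProd_succ, orbitProd_succ]
      ext <;> simp only <;> ring
    · rw [← h2, resProduct]
      field_simp

theorem contDiff_resFactor {A : ℝ → ℝ} (hA : ContDiff ℝ ∞ A) : ContDiff ℝ ∞ (resFactor A) :=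
  contDiff_const.add (contDiff_id.mul hA)

theorem contDiff_resProduct {A B : ℝ → ℝ} (hA : ContDiff ℝ ∞ A) (hB : ContDiff ℝ ∞ B) :
    ContDiff ℝ ∞ (resProduct A B) :=
  (contDiff_id.mul (contDiff_resFactor hA)).mul (contDiff_resFactor hB)

theorem contDiff_resonantNormalForm {lam : ℝ} {A B : ℝ → ℝ} (hA : ContDiff ℝ ∞ A)
    (hB : ContDiff ℝ ∞ B) : ContDiff ℝ ∞ (resonantNormalForm lam A B) := by
  have h : ContDiff ℝ ∞ (fun p : ℝ × ℝ => p.1 * p.2) := contDiff_fst.mul contDiff_snd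
  exact ((contDiff_const.mul contDiff_fst).mul ((contDiff_resFactor hA).comp h)).prodMk
    ((contDiff_const.mul contDiff_snd).mul ((contDiff_resFactor hB).comp h))

theorem hasDerivAt_mk_left {G : ℝ × ℝ → ℝ × ℝ} {x y : ℝ} (hG : DifferentiableAt ℝ G (x, y)) :
    HasDerivAt (fun t => G (t, y)) (fderiv ℝ G (x, y) (1, 0)) x :=
  hG.hasFDerivAt.comp_hasDerivAt x ((hasDerivAt_id x).prodMk (hasDerivAt_const x y))

theorem hasDerivAt_mk_right {G : ℝ × ℝ → ℝ × ℝ} {x y : ℝ} (hG : DifferentiableAt ℝ G (x, y)) :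
    HasDerivAt (fun t => G (x, t)) (fderiv ℝ G (x, y) (0, 1)) y :=
  hG.hasFDerivAt.comp_hasDerivAt y ((hasDerivAt_const y x).prodMk (hasDerivAt_id y))

theorem fderiv_iterate_resonantNormalForm {lam : ℝ} (hlam : lam ≠ 0) {A B : ℝ → ℝ}
    (hA : ContDiff ℝ ∞ A) (hB : ContDiff ℝ ∞ B) (j : ℕ) (x y P Q P' Q' : ℝ)
    (hP : orbitProd (resFactor A) (resProduct A B) j (x * y) = P)
    (hQ : orbitProd (resFactor B) (resProduct A B) j (x * y) = Q)
    (hP' : HasDerivAt (orbitProd (resFactor A) (resProduct A B) j) P' (x * y))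
    (hQ' : HasDerivAt (orbitProd (resFactor B) (resProduct A B) j) Q' (x * y)) :
    fderiv ℝ ((resonantNormalForm lam A B)^[j]) (x, y) (1, 0) =
        (lam ^ j * (P + x * y * P'), (1 / lam) ^ j * (y ^ 2 * Q')) ∧
      fderiv ℝ ((resonantNormalForm lam A B)^[j]) (x, y) (0, 1) =
        (lam ^ j * (x ^ 2 * P'), (1 / lam) ^ j * (Q + x * y * Q')) := by
  have hd : DifferentiableAt ℝ ((resonantNormalForm lam A B)^[j]) (x, y) :=
    (contDiff_iterate_endo (contDiff_resonantNormalForm hA hB) j).differentiable (by simp) _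
  have hl : HasDerivAt (fun t : ℝ => t * y) y x := by simpa using (hasDerivAt_id x).mul_const y
  have hr : HasDerivAt (fun t : ℝ => x * t) x y := by simpa using (hasDerivAt_id y).const_mul x
  constructor
  · refine (hasDerivAt_mk_left hd).unique ?_
    simp only [(iterate_resonantNormalForm hlam A B j _ _).1]
    refine (((hasDerivAt_id x).const_mul (lam ^ j)).mul (hP'.comp x hl)).prodMk
      ((hQ'.comp x hl).const_mul ((1 / lam) ^ j * y)) |>.congr_deriv ?_
    simp only [Function.comp_apply, hP, id]
    ext <;> simp only <;> ring
  · refine (hasDerivAt_mk_right hd).unique ?_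
    simp only [(iterate_resonantNormalForm hlam A B j _ _).1]
    refine ((hP'.comp y hr).const_mul (lam ^ j * x)).prodMk
      (((hasDerivAt_id y).const_mul ((1 / lam) ^ j)).mul (hQ'.comp y hr)) |>.congr_deriv ?_
    simp only [Function.comp_apply, hQ, id]
    ext <;> simp only <;> ring

/-! ### Transfer from the normal form to the map -/

/-- Two `C¹` maps that agree on a convex set with interior points have the same derivative there,
boundary points included. -/
theorem fderiv_eq_of_eqOn_convex {f g : ℝ × ℝ → ℝ × ℝ} (hf : ContDiff ℝ ∞ f)
    (hg : ContDiff ℝ ∞ g) {N : Set (ℝ × ℝ)} (hNc : Convex ℝ N) (hN : (interior N).Nonempty)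
    (h : ∀ p ∈ N, f p = g p) {p : ℝ × ℝ} (hp : p ∈ N) : fderiv ℝ f p = fderiv ℝ g p := by
  have hcl : IsClosed {q | fderiv ℝ f q = fderiv ℝ g q} :=
    isClosed_eq (hf.continuous_fderiv (by simp)) (hg.continuous_fderiv (by simp))
  have hsub : interior N ⊆ {q | fderiv ℝ f q = fderiv ℝ g q} := fun q hq =>
    Filter.EventuallyEq.fderiv_eq
      (eventually_of_mem (mem_interior_iff_mem_nhds.1 hq) fun r hr => h r hr)
  have hp' : p ∈ closure (interior N) := by
    rw [hNc.closure_interior_eq_closure_of_nonempty_interior hN]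
    exact subset_closure hp
  exact closure_minimal hsub hcl hp'

theorem iterate_eq_and_fderiv_iterate_eq {f g : ℝ × ℝ → ℝ × ℝ} (hf : ContDiff ℝ ∞ f)
    (hg : ContDiff ℝ ∞ g) {N : Set (ℝ × ℝ)} (hNc : Convex ℝ N) (hN : (interior N).Nonempty)
    (h : ∀ p ∈ N, f p = g p) {p : ℝ × ℝ} (k : ℕ) (hp : ∀ j < k, f^[j] p ∈ N) :
    f^[k] p = g^[k] p ∧ fderiv ℝ (f^[k]) p = fderiv ℝ (g^[k]) p := by
  induction k with
  | zero => simp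
  | succ k ih =>
    obtain ⟨h1, h2⟩ := ih fun j hj => hp j (hj.trans (Nat.lt_succ_self k))
    have hk := hp k (Nat.lt_succ_self k)
    refine ⟨?_, ?_⟩
    · rw [Function.iterate_succ_apply', Function.iterate_succ_apply', ← h1, h _ hk]
    · rw [Function.iterate_succ', Function.iterate_succ',
        fderiv_comp p (hf.differentiable (by simp) _)
          ((contDiff_iterate_endo hf k).differentiable (by simp) _),
        fderiv_comp p (hg.differentiable (by simp) _)
          ((contDiff_iterate_endo hg k).differentiable (by simp) _),
        h2, ← h1, fderiv_eq_of_eqOn_convex hf hg hNc hN h hk]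

/-- A cluster point lies in `closure S` and, by continuity of `F`, is sent to `b`; in a compact set
a unique possible cluster point is the limit. With `S` the whole space this covers the case of a
unique preimage. -/
theorem tendsto_of_unique_cluster {E : Type*} [MetricSpace E] {l : Filter ℕ} {p : ℕ → E}
    {F : E → E} (hF : Continuous F) {a b : E} {s S : Set E} (hs : IsCompact s)
    (hps : ∀ᶠ k in l, p k ∈ s) (hFp : Tendsto (fun k => F (p k)) l (𝓝 b))
    (hS : ∀ ε > 0, ∀ᶠ k in l, ∃ r ∈ S, dist (p k) r < ε)
    (h : ∀ q ∈ closure S, F q = b → q = a) : Tendsto p l (𝓝 a) := by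
  refine hs.le_nhds_of_unique_clusterPt (l := map p l) hps fun q _ hq => h q ?_ ?_
  · rw [Metric.mem_closure_iff]
    intro ε hε
    have h1 : ∃ᶠ k in l, p k ∈ Metric.ball q (ε / 2) :=
      (MapClusterPt.frequently hq (Metric.ball_mem_nhds q (half_pos hε)))
    obtain ⟨k, hk, r, hr, hkr⟩ := (h1.and_eventually (hS _ (half_pos hε))).exists
    refine ⟨r, hr, ?_⟩
    have h2 : dist q (p k) < ε / 2 := by rw [dist_comm]; exact hk
    linarith [dist_triangle q (p k) r]
  · have h1 : MapClusterPt (F q) l (F ∘ p) := MapClusterPt.continuousAt_comp hF.continuousAt hq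
    have h2 : ClusterPt (F q) (𝓝 b) := ClusterPt.mono h1 hFp
    exact eq_of_nhds_neBot h2

/-! ### The homoclinic orbit and its closure -/

section Homoclinic

variable {f : ℝ × ℝ → ℝ × ℝ} {lam sig : ℝ} {A B : ℝ → ℝ} {N : Set (ℝ × ℝ)} {xs ys : ℝ} {m : ℕ}

/-- The multiplier may be negative, so the points `r ^ j • v` can alternate between two rays; this
is why two points on each axis are required to lie in `N`. -/
theorem pow_eq_or_eq_mul_of_abs_lt_one {r : ℝ} (hr : |r| < 1) (j : ℕ) :
    (∃ t ∈ Set.Icc (0 : ℝ) 1, r ^ j = t) ∨ (∃ t ∈ Set.Icc (0 : ℝ) 1, r ^ j = t * r) := by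
  rcases le_total 0 r with h | h
  · exact Or.inl ⟨_, ⟨pow_nonneg h j,
      pow_le_one₀ h (by rw [abs_of_nonneg h] at hr; exact hr.le)⟩, rfl⟩
  · rcases Nat.even_or_odd j with he | ho
    · refine Or.inl ⟨_, ⟨he.pow_nonneg r, ?_⟩, rfl⟩
      rw [← he.pow_abs]
      exact pow_le_one₀ (abs_nonneg r) hr.le
    · obtain ⟨i, rfl⟩ := ho
      refine Or.inr ⟨r ^ (2 * i), ⟨(even_two_mul i).pow_nonneg r, ?_⟩, by rw [pow_succ]⟩
      rw [← (even_two_mul i).pow_abs]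
      exact pow_le_one₀ (abs_nonneg r) hr.le

/-- A convex set containing `0`, `v` and `r • v` contains all the points `r ^ j • v`. -/
theorem pow_smul_mem_of_convex (hNc : Convex ℝ N) (h0 : (0 : ℝ × ℝ) ∈ N) {v : ℝ × ℝ} {r : ℝ}
    (hr : |r| < 1) (h1 : v ∈ N) (h2 : r • v ∈ N) (j : ℕ) : r ^ j • v ∈ N := by
  rcases pow_eq_or_eq_mul_of_abs_lt_one hr j with ⟨t, ht, h⟩ | ⟨t, ht, h⟩
  · rw [h]; exact hNc.smul_mem_of_zero_mem h0 h1 ht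
  · rw [h, mul_smul]; exact hNc.smul_mem_of_zero_mem h0 h2 ht

theorem iterate_stable_axis (hlam1 : |lam| < 1) (hNc : Convex ℝ N) (h0 : (0 : ℝ × ℝ) ∈ N)
    (hfN : ∀ p ∈ N, f p = resonantNormalForm lam A B p)
    (hx0 : (xs, (0 : ℝ)) ∈ N) (hx1 : (lam * xs, (0 : ℝ)) ∈ N) (j : ℕ) :
    f^[j] (xs, 0) = (lam ^ j * xs, 0) := by
  induction j with
  | zero => simp
  | succ j ih =>
    have hm : (lam ^ j * xs, (0 : ℝ)) ∈ N := by
      have := pow_smul_mem_of_convex hNc h0 hlam1 hx0 (by simpa using hx1) j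
      simpa using this
    rw [Function.iterate_succ_apply', ih, hfN _ hm]
    simp [resonantNormalForm]
    ring

theorem apply_unstable_axis (hres : lam * sig = 1) (hlam1 : |lam| < 1) (hNc : Convex ℝ N)
    (h0 : (0 : ℝ × ℝ) ∈ N) (hfN : ∀ p ∈ N, f p = resonantNormalForm lam A B p)
    (hy1 : ((0 : ℝ), ys / sig) ∈ N) (hy2 : ((0 : ℝ), ys / sig ^ 2) ∈ N) (j : ℕ) :
    f (0, ys / sig ^ (j + 1)) = (0, ys / sig ^ j) := by
  have hl : lam = sig⁻¹ := eq_inv_of_mul_eq_one_left hres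
  have hs : sig ≠ 0 := right_ne_zero_of_mul_eq_one hres
  have hm : ((0 : ℝ), ys / sig ^ (j + 1)) ∈ N := by
    have := pow_smul_mem_of_convex hNc h0 hlam1 hy1 (by
      have h : lam • ((0 : ℝ), ys / sig) = (0, ys / sig ^ 2) := by
        rw [hl]; ext <;> simp; field_simp
      rw [h]; exact hy2) j
    have h : lam ^ j • ((0 : ℝ), ys / sig) = (0, ys / sig ^ (j + 1)) := by
      rw [hl]; ext <;> simp; field_simp; ring
    rwa [h] at this
  rw [hfN _ hm, hl]
  simp [resonantNormalForm]
  field_simp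
  ring

theorem iterate_unstable_axis (hres : lam * sig = 1) (hlam1 : |lam| < 1) (hNc : Convex ℝ N)
    (h0 : (0 : ℝ × ℝ) ∈ N) (hfN : ∀ p ∈ N, f p = resonantNormalForm lam A B p)
    (hy1 : ((0 : ℝ), ys / sig) ∈ N) (hy2 : ((0 : ℝ), ys / sig ^ 2) ∈ N) (i j : ℕ) :
    f^[i] (0, ys / sig ^ (j + i)) = (0, ys / sig ^ j) := by
  induction i with
  | zero => simp
  | succ i ih =>
    rw [Function.iterate_succ_apply, ← add_assoc,
      apply_unstable_axis hres hlam1 hNc h0 hfN hy1 hy2, ih]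

theorem pow_mul_ne_self (hlam1 : |lam| < 1) (hxs : xs ≠ 0) {j : ℕ} (hj : j ≠ 0) :
    lam ^ j * xs ≠ xs := by
  intro h
  have h1 : lam ^ j = 1 := mul_right_cancel₀ hxs (by rw [h, one_mul])
  have h2 := pow_lt_one₀ (abs_nonneg lam) hlam1 hj
  rw [← abs_pow, h1, abs_one] at h2
  exact lt_irrefl _ h2

/-- Among the points of the closure of the homoclinic orbit, only `(0, ys)` is mapped to `(xs, 0)`
by `f^m`. -/
theorem eq_of_mem_closure_homoclinicOrbit (hsig : 1 < |sig|)
    (hres : lam * sig = 1) (hlam1 : |lam| < 1) (hNc : Convex ℝ N)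
    (h0 : (0 : ℝ × ℝ) ∈ N) (hfN : ∀ p ∈ N, f p = resonantNormalForm lam A B p)
    (hxs : xs ≠ 0)
    (hx0 : (xs, (0 : ℝ)) ∈ N) (hx1 : (lam * xs, (0 : ℝ)) ∈ N)
    (hy1 : ((0 : ℝ), ys / sig) ∈ N) (hy2 : ((0 : ℝ), ys / sig ^ 2) ∈ N)
    (hhom : f^[m] (0, ys) = (xs, 0)) {q : ℝ × ℝ}
    (hq : q ∈ closure (homoclinicOrbit f sig ys)) (hfq : f^[m] q = (xs, 0)) : q = (0, ys) := by
  have hfx := iterate_stable_axis hlam1 hNc h0 hfN hx0 hx1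
  have hfy := iterate_unstable_axis hres hlam1 hNc h0 hfN hy1 hy2
  have ht1 : Tendsto (fun j : ℕ => ((0 : ℝ), ys / sig ^ j)) atTop (𝓝 0) := by
    have h1 : Tendsto (fun j : ℕ => ys * sig⁻¹ ^ j) atTop (𝓝 (ys * 0)) :=
      (tendsto_pow_atTop_nhds_zero_of_abs_lt_one
        (by rw [abs_inv]; exact inv_lt_one_of_one_lt₀ hsig)).const_mul ys
    have h2 : Tendsto (fun j : ℕ => ys / sig ^ j) atTop (𝓝 0) := by
      simpa [div_eq_mul_inv] using h1
    exact tendsto_const_nhds.prodMk_nhds h2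
  have ht2 : Tendsto (fun j : ℕ => f^[j] (0, ys)) atTop (𝓝 0) := by
    rw [← tendsto_add_atTop_iff_nat m]
    have h1 : Tendsto (fun j : ℕ => lam ^ j * xs) atTop (𝓝 (0 * xs)) :=
      (tendsto_pow_atTop_nhds_zero_of_abs_lt_one hlam1).mul_const xs
    rw [zero_mul] at h1
    have h2 : (fun j : ℕ => f^[j + m] (0, ys)) = fun j => (lam ^ j * xs, (0 : ℝ)) := by
      funext j
      rw [Function.iterate_add_apply, hhom, hfx]
    rw [h2]
    exact h1.prodMk_nhds tendsto_const_nhds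
  -- Both halves of the orbit converge to the saddle, so taking the closure adds only the origin.
  have hcl : IsClosed (insert 0 (Set.range fun j : ℕ => ((0 : ℝ), ys / sig ^ j)) ∪
      insert 0 (Set.range fun j : ℕ => f^[j] (0, ys))) :=
    ht1.isCompact_insert_range.isClosed.union ht2.isCompact_insert_range.isClosed
  have hsub : homoclinicOrbit f sig ys ⊆
      insert 0 (Set.range fun j : ℕ => ((0 : ℝ), ys / sig ^ j)) ∪
      insert 0 (Set.range fun j : ℕ => f^[j] (0, ys)) := by
    rintro r ⟨j, rfl | rfl⟩
    · exact Or.inl (Or.inr ⟨j, rfl⟩)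
    · exact Or.inr (Or.inr ⟨j, rfl⟩)
  have hf0 : f^[m] 0 = 0 := Function.iterate_fixed (by rw [hfN 0 h0]; simp [resonantNormalForm]) m
  have hne0 : q ≠ 0 := by
    rintro rfl
    rw [hf0] at hfq
    exact hxs (congrArg Prod.fst hfq).symm
  have hfwd : ∀ j, q = f^[j] (0, ys) → q = (0, ys) := by
    intro j hj
    by_cases hj0 : j = 0
    · rw [hj, hj0]; rfl
    · exfalso
      rw [hj, ← Function.iterate_add_apply, add_comm, Function.iterate_add_apply, hhom, hfx] at hfq
      exact pow_mul_ne_self hlam1 hxs hj0 (congrArg Prod.fst hfq)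
  rcases closure_minimal hsub hcl hq with (h | ⟨j, h⟩) | (h | ⟨j, h⟩)
  · exact absurd h hne0
  · simp only at h
    by_cases hj0 : j = 0
    · rw [← h, hj0]; simp
    · exfalso
      -- With `j ≥ m` the image is still on the unstable axis. Otherwise the orbit of `(0, ys)`
      -- reaches `(xs, 0)` already after `m - j` steps, hence is at `(lam ^ j * xs, 0)` after `m`
      -- steps, against `hhom`.
      rcases le_total m j with hmj | hmj
      · obtain ⟨i, rfl⟩ := Nat.exists_eq_add_of_le' hmj
        rw [← h, hfy m i] at hfq
        exact hxs (congrArg Prod.fst hfq).symm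
      · obtain ⟨i, rfl⟩ := Nat.exists_eq_add_of_le' hmj
        have h1 := hfy j 0
        rw [zero_add, h, pow_zero, div_one] at h1
        rw [Function.iterate_add_apply, h1] at hfq
        have h2 := hhom
        rw [add_comm, Function.iterate_add_apply, hfq, hfx] at h2
        exact pow_mul_ne_self hlam1 hxs hj0 (congrArg Prod.fst h2)
  · exact absurd h hne0
  · exact hfwd j h.symm

end Homoclinic

/-! ### Uniform estimates along orbits of growing length -/

/-- The filter on pairs `(k, j)` with `j ≤ k` for which convergence means convergence as `k` tends
along `l`, uniformly in `j ≤ k`. -/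
def triangleFilter (l : Filter ℕ) : Filter (ℕ × ℕ) := comap Prod.fst l ⊓ 𝓟 {p | p.2 ≤ p.1}

theorem eventually_triangleFilter {l : Filter ℕ} {s : ℕ × ℕ → Prop} :
    (∀ᶠ p in triangleFilter l, s p) ↔ ∀ᶠ k in l, ∀ j ≤ k, s (k, j) := by
  rw [triangleFilter, eventually_inf_principal, eventually_comap]
  refine eventually_congr (Eventually.of_forall fun k => ?_)
  constructor
  · intro h j hj
    exact h (k, j) rfl hj
  · rintro h ⟨k', j⟩ rfl hj
    exact h j hj

theorem tendsto_fst_triangleFilter (l : Filter ℕ) : Tendsto Prod.fst (triangleFilter l) l :=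
  tendsto_comap.mono_left inf_le_left

theorem tendsto_diag_triangleFilter (l : Filter ℕ) :
    Tendsto (fun k => (k, k)) l (triangleFilter l) := by
  intro s hs
  have h : ∀ᶠ p in triangleFilter l, p ∈ s := hs
  rw [eventually_triangleFilter] at h
  exact h.mono fun k hk => hk k le_rfl

/-- A Cesàro mean for triangular arrays: uniformity in `j` bounds every term of the average at once.
-/
theorem tendsto_average {l : Filter ℕ} (hl : l ≤ atTop) {F : ℕ × ℕ → ℝ} {c : ℝ}
    (hF : Tendsto F (triangleFilter l) (𝓝 c)) :
    Tendsto (fun k : ℕ => (∑ j ∈ Finset.range k, F (k, j)) / k) l (𝓝 c) := by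
  rw [Metric.tendsto_nhds] at hF ⊢
  intro ε hε
  filter_upwards [eventually_triangleFilter.1 (hF (ε / 2) (half_pos hε)),
    hl (eventually_gt_atTop 0)] with k hk hk0
  have hk0' : (0 : ℝ) < k := Nat.cast_pos.2 hk0
  have h1 : (∑ j ∈ Finset.range k, F (k, j)) / k - c =
      (∑ j ∈ Finset.range k, (F (k, j) - c)) / k := by
    rw [Finset.sum_sub_distrib, Finset.sum_const, Finset.card_range, nsmul_eq_mul]
    field_simp
  rw [Real.dist_eq, h1, abs_div, abs_of_pos hk0', div_lt_iff₀ hk0']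
  calc |∑ j ∈ Finset.range k, (F (k, j) - c)|
      ≤ ∑ j ∈ Finset.range k, |F (k, j) - c| := Finset.abs_sum_le_sum_abs _ _
    _ ≤ ∑ j ∈ Finset.range k, ε / 2 := Finset.sum_le_sum fun j hj => by
        have := hk j (Finset.mem_range.1 hj).le
        rw [Real.dist_eq] at this
        exact this.le
    _ = k * (ε / 2) := by rw [Finset.sum_const, Finset.card_range, nsmul_eq_mul]
    _ < ε * k := by nlinarith

theorem exists_abs_sub_one_le {a : ℝ → ℝ} (ha : DifferentiableAt ℝ a 0) (ha0 : a 0 = 1) :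
    ∃ M > 0, ∀ᶠ t in 𝓝 (0 : ℝ), |a t - 1| ≤ M * |t| := by
  obtain ⟨M, hM, h⟩ := ha.hasDerivAt.isBigO_sub.exists_pos
  refine ⟨M, hM, h.bound.mono fun t ht => ?_⟩
  simpa [ha0] using ht

/-- Along orbits whose points are summably small, the products of a function with value one at zero
tend to one. -/
theorem tendsto_orbitProd {l : Filter ℕ} {a g : ℝ → ℝ} (ha : DifferentiableAt ℝ a 0)
    (ha0 : a 0 = 1) {h0 b : ℕ → ℝ} (hb : ∀ᶠ k in l, ∀ j ≤ k, |g^[j] (h0 k)| ≤ b k)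
    (hb0 : Tendsto b l (𝓝 0)) (hkb : Tendsto (fun k : ℕ => k * b k) l (𝓝 0)) :
    Tendsto (fun p : ℕ × ℕ => orbitProd a g p.2 (h0 p.1)) (triangleFilter l) (𝓝 1) := by
  obtain ⟨M, hM, hMa⟩ := exists_abs_sub_one_le ha ha0
  obtain ⟨R, hR, hball⟩ := Metric.eventually_nhds_iff.1 hMa
  have hexp : Tendsto (fun k : ℕ => Real.exp (M * (k * b k)) - 1) l (𝓝 0) := by
    have h1 := (Real.continuous_exp.tendsto _).comp (hkb.const_mul M)
    simpa using h1.sub_const 1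
  rw [Metric.tendsto_nhds]
  intro ε hε
  rw [eventually_triangleFilter]
  filter_upwards [hb, hb0.eventually (gt_mem_nhds hR), hexp.eventually (gt_mem_nhds hε)]
    with k hk hbR hke j hj
  rw [Real.dist_eq]
  refine lt_of_le_of_lt ?_ hke
  -- The product differs from 1 by at most `exp (∑ |a - 1|) - 1`, and the sum is at most `M * (k * b
  -- k)`, independently of `j`.
  have h1 := Finset.norm_prod_one_add_sub_one_le (Finset.range j) fun i => a (g^[i] (h0 k)) - 1
  simp only [add_sub_cancel, Real.norm_eq_abs] at h1
  refine h1.trans ?_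
  have hterm : ∀ i ∈ Finset.range j, |a (g^[i] (h0 k)) - 1| ≤ M * b k := by
    intro i hi
    have hik : i ≤ k := (Finset.mem_range.1 hi).le.trans hj
    have h2 := hk i hik
    have h3 := hball (y := g^[i] (h0 k)) (by rw [Real.dist_eq, sub_zero]; exact h2.trans_lt hbR)
    exact h3.trans (by gcongr)
  have hbk : 0 ≤ b k := (abs_nonneg _).trans (hk 0 (Nat.zero_le k))
  have hsum : ∑ i ∈ Finset.range j, |a (g^[i] (h0 k)) - 1| ≤ M * (k * b k) := by
    refine (Finset.sum_le_sum hterm).trans ?_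
    rw [Finset.sum_const, Finset.card_range, nsmul_eq_mul]
    have hjk : (j : ℝ) ≤ k := Nat.cast_le.2 hj
    have : (j : ℝ) * (M * b k) ≤ k * (M * b k) := by gcongr
    linarith
  gcongr

theorem iterate_resProduct (A B : ℝ → ℝ) (j : ℕ) (h : ℝ) :
    (resProduct A B)^[j] h = h * orbitProd (resFactor A) (resProduct A B) j h *
      orbitProd (resFactor B) (resProduct A B) j h := by
  induction j with
  | zero => simp [orbitProd]
  | succ j ih =>
    rw [Function.iterate_succ_apply', orbitProd_succ, orbitProd_succ]
    nth_rewrite 1 [resProduct]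
    nth_rewrite 1 [ih]
    ring

/-- Telescoping the partial products gives an exact sum, whose terms can be averaged without taking
logarithms. -/
theorem orbitProd_resFactor_sub_one (A g : ℝ → ℝ) (k : ℕ) (h : ℝ) :
    orbitProd (resFactor A) g k h - 1 =
      ∑ j ∈ Finset.range k, orbitProd (resFactor A) g j h * (g^[j] h * A (g^[j] h)) := by
  have h1 := Finset.sum_range_sub (fun j => orbitProd (resFactor A) g j h) k
  have h0 : orbitProd (resFactor A) g 0 h = 1 := by simp [orbitProd]
  rw [h0] at h1
  rw [← h1]
  refine Finset.sum_congr rfl fun j _ => ?_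
  rw [orbitProd_succ, resFactor]
  ring

/-- `X` decays forwards from `X 0` and `Y` decays backwards from `Y k`; the rates `μ ^ j` and `μ ^
(k - j)` multiply to `μ ^ k`, whatever `j` is. -/
theorem abs_mul_le_of_hyperbolic {lam μ : ℝ} (hμ : 0 ≤ μ) (hlam : lam ≠ 0) {k : ℕ}
    {X Y a b : ℕ → ℝ} (hX : ∀ j < k, X (j + 1) = lam * X j * a j)
    (hY : ∀ j < k, Y (j + 1) = 1 / lam * Y j * b j) (ha : ∀ j < k, |lam * a j| ≤ μ)
    (hb : ∀ j < k, |lam| ≤ μ * |b j|) {j : ℕ} (hj : j ≤ k) :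
    |X j * Y j| ≤ μ ^ k * (|X 0| * |Y k|) := by
  have h1 : ∀ j ≤ k, |X j| ≤ μ ^ j * |X 0| := by
    intro j
    induction j with
    | zero => simp
    | succ j ih =>
      intro hj
      have h2 := ih (Nat.le_of_succ_le hj)
      rw [hX j hj, show lam * X j * a j = lam * a j * X j by ring, abs_mul, pow_succ]
      calc |lam * a j| * |X j| ≤ μ * (μ ^ j * |X 0|) := by gcongr; exact ha j hj
        _ = μ ^ j * μ * |X 0| := by ring
  have h3 : ∀ i, ∀ j, j + i = k → |Y j| ≤ μ ^ i * |Y k| := by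
    intro i
    induction i with
    | zero => intro j hj; simp at hj; simp [hj]
    | succ i ih =>
      intro j hj
      have hjk : j < k := by omega
      have h4 := ih (j + 1) (by omega)
      have h5 : |lam| * |Y j| ≤ |lam| * (μ * |Y (j + 1)|) := by
        have h6 : |lam| * |Y (j + 1)| = |Y j| * |b j| := by
          rw [hY j hjk, ← abs_mul, ← abs_mul]
          congr 1
          field_simp
        calc |lam| * |Y j| ≤ (μ * |b j|) * |Y j| := by gcongr; exact hb j hjk
          _ = μ * (|Y j| * |b j|) := by ring
          _ = |lam| * (μ * |Y (j + 1)|) := by rw [← h6]; ring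
      have h7 := le_of_mul_le_mul_left h5 (abs_pos.2 hlam)
      calc |Y j| ≤ μ * |Y (j + 1)| := h7
        _ ≤ μ * (μ ^ i * |Y k|) := by gcongr
        _ = μ ^ (i + 1) * |Y k| := by ring
  obtain ⟨i, hi⟩ := Nat.exists_eq_add_of_le hj
  rw [abs_mul]
  calc |X j| * |Y j| ≤ (μ ^ j * |X 0|) * (μ ^ i * |Y k|) := by
        gcongr
        · exact h1 j hj
        · exact h3 i j hi.symm
    _ = μ ^ k * (|X 0| * |Y k|) := by
        rw [show μ ^ k = μ ^ j * μ ^ i by rw [← pow_add, ← hi]]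
        ring

/-! ### Asymptotics of the products along the passage -/

section Passage

variable {l : Filter ℕ} {lam : ℝ} {A B : ℝ → ℝ} {x0 y0 yk b : ℕ → ℝ} {xs ys : ℝ}

theorem tendsto_iterate_zero {g : ℝ → ℝ} {h0 b : ℕ → ℝ}
    (hb : ∀ᶠ k in l, ∀ j ≤ k, |g^[j] (h0 k)| ≤ b k) (hb0 : Tendsto b l (𝓝 0)) :
    Tendsto (fun p : ℕ × ℕ => g^[p.2] (h0 p.1)) (triangleFilter l) (𝓝 0) :=
  squeeze_zero_norm' (a := fun p : ℕ × ℕ => b p.1) (eventually_triangleFilter.2 hb)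
    (hb0.comp (tendsto_fst_triangleFilter l))

/-- The products `h_j` along the passage near the saddle are asymptotic to `lam ^ k * xs * ys`. -/
theorem tendsto_iterate_resProduct_div (hlam : lam ≠ 0)
    (hA : DifferentiableAt ℝ (resFactor A) 0) (hB : DifferentiableAt ℝ (resFactor B) 0)
    (hx0 : Tendsto x0 l (𝓝 xs)) (hyk : Tendsto yk l (𝓝 ys))
    (hy : ∀ᶠ k in l, yk k = (1 / lam) ^ k * y0 k *
      orbitProd (resFactor B) (resProduct A B) k (x0 k * y0 k))
    (hb : ∀ᶠ k in l, ∀ j ≤ k, |(resProduct A B)^[j] (x0 k * y0 k)| ≤ b k)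
    (hb0 : Tendsto b l (𝓝 0)) (hkb : Tendsto (fun k : ℕ => k * b k) l (𝓝 0)) :
    Tendsto (fun p : ℕ × ℕ => (resProduct A B)^[p.2] (x0 p.1 * y0 p.1) / lam ^ p.1)
      (triangleFilter l) (𝓝 (xs * ys)) := by
  have hP := tendsto_orbitProd hA (by simp [resFactor]) hb hb0 hkb
  have hQ := tendsto_orbitProd hB (by simp [resFactor]) hb hb0 hkb
  have hQk := hQ.comp ((tendsto_diag_triangleFilter l).comp (tendsto_fst_triangleFilter l))
  -- Here `h_j = h_0 * P_j * Q_j`, and the arrival condition gives `h_0 = lam ^ k * x0 * yk / Q_k`;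
  -- all the products tend to 1.
  have hmain := (((hx0.comp (tendsto_fst_triangleFilter l)).mul
    (hyk.comp (tendsto_fst_triangleFilter l))).div hQk one_ne_zero).mul (hP.mul hQ)
  simp only [mul_one, div_one] at hmain
  refine hmain.congr' ?_
  filter_upwards [(tendsto_fst_triangleFilter l).eventually hy, hQk.eventually_ne one_ne_zero]
    with p hp hne
  simp only [Pi.div_apply, Function.comp_apply] at hne ⊢
  rw [hp, iterate_resProduct A B p.2, one_div, inv_pow]
  field_simp

/-- In the telescoped sum each of the `k` terms, divided by `lam ^ k`, tends uniformly to `c * C 0`.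
-/
theorem tendsto_orbitProd_resFactor_sub_one_div (hl : l ≤ atTop) {C : ℝ → ℝ} {g : ℝ → ℝ}
    {h0 b : ℕ → ℝ} {c : ℝ}
    (hC : DifferentiableAt ℝ (resFactor C) 0) (hC0 : ContinuousAt C 0)
    (hb : ∀ᶠ k in l, ∀ j ≤ k, |g^[j] (h0 k)| ≤ b k)
    (hb0 : Tendsto b l (𝓝 0)) (hkb : Tendsto (fun k : ℕ => k * b k) l (𝓝 0))
    (hh : Tendsto (fun p : ℕ × ℕ => g^[p.2] (h0 p.1) / lam ^ p.1) (triangleFilter l) (𝓝 c)) :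
    Tendsto (fun k : ℕ => (orbitProd (resFactor C) g k (h0 k) - 1) / (k * lam ^ k)) l
      (𝓝 (c * C 0)) := by
  have hP := tendsto_orbitProd hC (by simp [resFactor]) hb hb0 hkb
  have hCh : Tendsto (fun p : ℕ × ℕ => C (g^[p.2] (h0 p.1))) (triangleFilter l) (𝓝 (C 0)) :=
    hC0.tendsto.comp (tendsto_iterate_zero hb hb0)
  have h1 := tendsto_average hl (hP.mul (hh.mul hCh))
  rw [one_mul] at h1
  refine h1.congr fun k => ?_
  rw [orbitProd_resFactor_sub_one, Finset.sum_div, Finset.sum_div]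
  refine Finset.sum_congr rfl fun j _ => ?_
  simp only
  rw [mul_comm (k : ℝ) (lam ^ k), ← div_div]
  ring

/-- As `deriv g 0 = 1`, the derivatives of the iterates of `g` tend to 1 uniformly, so each summand
tends to `deriv a 0`. -/
theorem tendsto_orbitLogDeriv_div (hl : l ≤ atTop) {a g : ℝ → ℝ} {h0 b : ℕ → ℝ}
    (ha : DifferentiableAt ℝ a 0) (ha0 : a 0 = 1) (ha1 : ContinuousAt (deriv a) 0)
    (hg : DifferentiableAt ℝ (deriv g) 0) (hg0 : deriv g 0 = 1)
    (hb : ∀ᶠ k in l, ∀ j ≤ k, |g^[j] (h0 k)| ≤ b k)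
    (hb0 : Tendsto b l (𝓝 0)) (hkb : Tendsto (fun k : ℕ => k * b k) l (𝓝 0)) :
    Tendsto (fun k : ℕ => orbitLogDeriv a g k (h0 k) / k) l (𝓝 (deriv a 0)) := by
  have hh := tendsto_iterate_zero hb hb0
  have hE := tendsto_orbitProd hg hg0 hb hb0 hkb
  have h1 : Tendsto (fun p : ℕ × ℕ => deriv a (g^[p.2] (h0 p.1)) *
      orbitProd (deriv g) g p.2 (h0 p.1) / a (g^[p.2] (h0 p.1))) (triangleFilter l)
      (𝓝 (deriv a 0 * 1 / a 0)) :=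
    Tendsto.div ((ha1.tendsto.comp hh).mul hE) (ha.continuousAt.tendsto.comp hh)
      (by rw [ha0]; exact one_ne_zero)
  rw [ha0, mul_one, div_one] at h1
  simpa only [orbitLogDeriv] using tendsto_average hl h1

end Passage

/-! ### Local expansion of the global map -/

section LocalExpansion

variable {F : ℝ × ℝ → ℝ × ℝ} {ys : ℝ}

theorem contDiff_fderiv_apply_snd (hF : ContDiff ℝ ∞ F) (v : ℝ × ℝ) :
    ContDiff ℝ ∞ (fun p => (fderiv ℝ F p v).2) :=
  ((hF.fderiv_right (m := ∞) (by simp)).clm_apply contDiff_const).snd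

theorem hasDerivAt_snd_mk_left (hF : ContDiff ℝ ∞ F) (x y : ℝ) :
    HasDerivAt (fun t => (F (t, y)).2) (fderiv ℝ F (x, y) (1, 0)).2 x :=
  (ContinuousLinearMap.snd ℝ ℝ ℝ).hasFDerivAt.comp_hasDerivAt x
    (hasDerivAt_mk_left (hF.differentiable (by simp) (x, y)))

theorem hasDerivAt_snd_mk_right (hF : ContDiff ℝ ∞ F) (x y : ℝ) :
    HasDerivAt (fun t => (F (x, t)).2) (fderiv ℝ F (x, y) (0, 1)).2 y :=
  (ContinuousLinearMap.snd ℝ ℝ ℝ).hasFDerivAt.comp_hasDerivAt y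
    (hasDerivAt_mk_right (hF.differentiable (by simp) (x, y)))

theorem deriv_snd_mk_right (hF : ContDiff ℝ ∞ F) (x : ℝ) :
    deriv (fun t => (F (x, t)).2) = fun y => (fderiv ℝ F (x, y) (0, 1)).2 :=
  funext fun y => (hasDerivAt_snd_mk_right hF x y).deriv

theorem contDiff_snd_mk_right (hF : ContDiff ℝ ∞ F) (x : ℝ) :
    ContDiff ℝ ∞ (fun t => (F (x, t)).2) :=
  (hF.comp (contDiff_const.prodMk contDiff_id)).snd

/-- Mean value inequality in `x` at fixed `y`. The factor `|p.1|` in the error is essential: it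
supplies one power of `lam ^ k` and the norm the other. -/
theorem exists_snd_sub_bound (hF : ContDiff ℝ ∞ F) :
    ∃ C, 0 ≤ C ∧ ∀ᶠ p in 𝓝 ((0 : ℝ), ys),
      |(F p).2 - (F (0, p.2)).2 - (fderiv ℝ F (0, ys) (1, 0)).2 * p.1| ≤
        C * |p.1| * ‖p - (0, ys)‖ := by
  set d := (fderiv ℝ F (0, ys) (1, 0)).2 with hd
  have hdiff : DifferentiableAt ℝ (fun p => (fderiv ℝ F p (1, 0)).2) (0, ys) :=
    (contDiff_fderiv_apply_snd hF (1, 0)).differentiable (by simp) _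
  obtain ⟨C, hC, hbd⟩ := hdiff.hasFDerivAt.isBigO_sub.exists_pos
  obtain ⟨R, hR, hball⟩ := Metric.eventually_nhds_iff.1 hbd.bound
  refine ⟨C, hC.le, Metric.eventually_nhds_iff.2 ⟨R, hR, ?_⟩⟩
  rintro ⟨x, y⟩ hp
  rw [dist_eq_norm] at hp
  set s : Set ℝ := Metric.closedBall 0 |x| with hs
  have hderiv : ∀ t ∈ s, HasDerivWithinAt (fun t => (F (t, y)).2 - d * t)
      ((fderiv ℝ F (t, y) (1, 0)).2 - d * 1) s t := fun t _ =>
    ((hasDerivAt_snd_mk_left hF t y).sub ((hasDerivAt_id t).const_mul d)).hasDerivWithinAt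
  have hbound : ∀ t ∈ s, ‖(fderiv ℝ F (t, y) (1, 0)).2 - d * 1‖ ≤ C * ‖(x, y) - (0, ys)‖ := by
    intro t ht
    have ht' : |t| ≤ |x| := by simpa [hs] using ht
    have hle : ‖((t, y) : ℝ × ℝ) - (0, ys)‖ ≤ ‖((x, y) : ℝ × ℝ) - (0, ys)‖ := by
      simp only [Prod.mk_sub_mk, Prod.norm_mk, sub_zero, Real.norm_eq_abs]
      exact max_le_max ht' le_rfl
    have h1 := hball (y := ((t, y) : ℝ × ℝ)) (by rw [dist_eq_norm]; exact hle.trans_lt hp)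
    rw [mul_one]
    exact h1.trans (by gcongr)
  have h2 := (convex_closedBall (0 : ℝ) |x|).norm_image_sub_le_of_norm_hasDerivWithin_le hderiv
    hbound (x := 0) (y := x) (Metric.mem_closedBall_self (abs_nonneg x))
    (by rw [hs, mem_closedBall_zero_iff, Real.norm_eq_abs])
  simp only [mul_zero, sub_zero, Real.norm_eq_abs] at h2
  calc _ = |(F (x, y)).2 - d * x - (F (0, y)).2| := by congr 1; ring
    _ ≤ _ := h2
    _ = _ := by ring

/-- Taylor expansion on the line `x = 0`, with the remainder kept as a vanishing correction `φ` of
the quadratic coefficient, so that it needs no size estimate for `y - ys`. -/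
theorem exists_snd_expansion (hF : ContDiff ℝ ∞ F) (hF0 : (F (0, ys)).2 = 0)
    (h1 : (fderiv ℝ F (0, ys) (0, 1)).2 = 0) :
    ∃ C, 0 ≤ C ∧ ∃ φ : ℝ → ℝ, Tendsto φ (𝓝 ys) (𝓝 0) ∧ ∀ᶠ p in 𝓝 ((0 : ℝ), ys),
      |(F p).2 - ((fderiv ℝ F (0, ys) (1, 0)).2 * p.1 +
        (iteratedDeriv 2 (fun y : ℝ => (F (0, y)).2) ys / 2 + φ p.2) * (p.2 - ys) ^ 2)| ≤
        C * |p.1| * ‖p - (0, ys)‖ := by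
  obtain ⟨C, hC, h⟩ := exists_snd_sub_bound (ys := ys) hF
  have ht := taylor_isLittleO_univ (x₀ := ys) (n := 2)
    (contDiff_infty.1 (contDiff_snd_mk_right hF 0) 2)
  obtain ⟨φ, hφ, heq⟩ := Asymptotics.isLittleO_iff_exists_eq_mul.1 ht
  refine ⟨C, hC, φ, hφ, ?_⟩
  have hsnd : Tendsto Prod.snd (𝓝 ((0 : ℝ), ys)) (𝓝 ys) := continuous_snd.tendsto _
  filter_upwards [h, hsnd.eventually heq] with p hp hq
  have hfirst : iteratedDeriv 1 (fun y : ℝ => (F (0, y)).2) ys = 0 := by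
    rw [iteratedDeriv_one, deriv_snd_mk_right hF]; exact h1
  simp only [taylorWithinEval_succ, taylor_within_zero_eval, iteratedDerivWithin_univ,
    Pi.mul_apply, hF0, smul_eq_mul, zero_add, hfirst, mul_zero] at hq
  norm_num at hq
  refine le_trans (le_of_eq ?_) hp
  congr 1
  linear_combination hq

/-- Moving to the line `x = 0` costs a Lipschitz error in `|p.1|`; on that line it is
differentiability of `∂F₂/∂y` at `ys`. -/
theorem exists_fderiv_snd_expansion (hF : ContDiff ℝ ∞ F)
    (h1 : (fderiv ℝ F (0, ys) (0, 1)).2 = 0) :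
    ∃ C, 0 ≤ C ∧ ∃ φ : ℝ → ℝ, Tendsto φ (𝓝 ys) (𝓝 0) ∧ ∀ᶠ p in 𝓝 ((0 : ℝ), ys),
      |(fderiv ℝ F p (0, 1)).2 -
        (iteratedDeriv 2 (fun y : ℝ => (F (0, y)).2) ys + φ p.2) * (p.2 - ys)| ≤ C * |p.1| := by
  obtain ⟨C, t, ht, hlip⟩ := (contDiff_infty.1
    (contDiff_fderiv_apply_snd hF (0, 1)) 1).contDiffAt.exists_lipschitzOnWith (x := ((0 : ℝ), ys))
  have hd : HasDerivAt (fun y => (fderiv ℝ F (0, y) (0, 1)).2)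
      (iteratedDeriv 2 (fun y : ℝ => (F (0, y)).2) ys) ys := by
    rw [iteratedDeriv_succ, iteratedDeriv_one, deriv_snd_mk_right hF]
    have : ContDiff ℝ ∞ (fun y => (fderiv ℝ F (0, y) (0, 1)).2) :=
      (contDiff_fderiv_apply_snd hF (0, 1)).comp (contDiff_const.prodMk contDiff_id)
    exact (this.differentiable (by simp) ys).hasDerivAt
  obtain ⟨φ, hφ, heq⟩ := Asymptotics.isLittleO_iff_exists_eq_mul.1 (hasDerivAt_iff_isLittleO.1 hd)
  refine ⟨C, C.2, φ, hφ, ?_⟩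
  have hsnd : Tendsto Prod.snd (𝓝 ((0 : ℝ), ys)) (𝓝 ys) := continuous_snd.tendsto _
  have hproj : Tendsto (fun p : ℝ × ℝ => ((0 : ℝ), p.2)) (𝓝 ((0 : ℝ), ys)) (𝓝 (0, ys)) :=
    tendsto_const_nhds.prodMk_nhds hsnd
  filter_upwards [ht, hproj ht, hsnd.eventually heq] with p hp hp' hq
  have h2 := hlip.dist_le_mul p hp _ hp'
  simp only [h1, sub_zero, smul_eq_mul, Pi.mul_apply] at hq
  have h3 : dist p ((0 : ℝ), p.2) = |p.1| := by
    rw [Prod.dist_eq]; simp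
  rw [h3, Real.dist_eq] at h2
  refine le_trans (le_of_eq ?_) h2
  congr 1
  linear_combination hq

end LocalExpansion

/-! ### Size of the deviation of the arrival point -/

/-- Passing to the limit in `v² φ = w + r` when `r` is small compared with `1 + v²`. -/
theorem tendsto_sq_of_eq {l : Filter ℕ} {v φ w r δ : ℕ → ℝ} {d c : ℝ} (hd : d ≠ 0)
    (hφ : Tendsto φ l (𝓝 d)) (hw : Tendsto w l (𝓝 c)) (hδ : Tendsto δ l (𝓝 0))
    (hr : ∀ᶠ k in l, |r k| ≤ δ k * (1 + v k ^ 2))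
    (heq : ∀ᶠ k in l, v k ^ 2 * φ k = w k + r k) :
    Tendsto (fun k => v k ^ 2) l (𝓝 (c / d)) := by
  have hpos : ∀ k, 0 < 1 + v k ^ 2 := fun k => by positivity
  -- With `s = r / (1 + v²)` the equation becomes `v² * (φ - s) = w + s`, so no prior bound on `v`
  -- is needed.
  have hs : Tendsto (fun k => r k / (1 + v k ^ 2)) l (𝓝 0) := by
    refine squeeze_zero_norm' ?_ hδ
    filter_upwards [hr] with k hk
    rw [Real.norm_eq_abs, abs_div, abs_of_pos (hpos k), div_le_iff₀ (hpos k)]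
    exact hk
  have hden : Tendsto (fun k => φ k - r k / (1 + v k ^ 2)) l (𝓝 d) := by
    simpa using hφ.sub hs
  have hnum : Tendsto (fun k => w k + r k / (1 + v k ^ 2)) l (𝓝 c) := by
    simpa using hw.add hs
  refine (hnum.div hden hd).congr' ?_
  filter_upwards [heq, hden.eventually_ne hd] with k hk hne
  simp only [Pi.div_apply]
  rw [div_eq_iff hne]
  have h1 : r k = r k / (1 + v k ^ 2) * (1 + v k ^ 2) := by
    rw [div_mul_cancel₀ _ (hpos k).ne']
  linear_combination -hk - h1

/-- Single-round orbits: the orbit of `p k` under the resonant normal form arrives after `k` steps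
at `q k`, which the global map `F` sends back to `p k`; the products `x y` along the passage are
bounded by `b k`, and `k * b k` tends to zero along `l`. -/
structure SingleRoundPassage (l : Filter ℕ) (lam : ℝ) (A B : ℝ → ℝ) (F : ℝ × ℝ → ℝ × ℝ)
    (xs ys : ℝ) (p q : ℕ → ℝ × ℝ) (b : ℕ → ℝ) : Prop where
  le_atTop : l ≤ atTop
  lam_ne : lam ≠ 0
  lam_lt : |lam| < 1
  smooth_A : ContDiff ℝ ∞ A
  smooth_B : ContDiff ℝ ∞ B
  smooth_F : ContDiff ℝ ∞ F
  tendsto_p : Tendsto p l (𝓝 (xs, 0))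
  tendsto_q : Tendsto q l (𝓝 (0, ys))
  map_q : ∀ᶠ k in l, F (q k) = p k
  q_eq : ∀ᶠ k in l, q k = (resonantNormalForm lam A B)^[k] (p k)
  bound : ∀ᶠ k in l, ∀ j ≤ k, |(resProduct A B)^[j] ((p k).1 * (p k).2)| ≤ b k
  tendsto_b : Tendsto b l (𝓝 0)
  tendsto_kb : Tendsto (fun k : ℕ => k * b k) l (𝓝 0)

namespace SingleRoundPassage

variable {l : Filter ℕ} {lam : ℝ} {A B : ℝ → ℝ} {F : ℝ × ℝ → ℝ × ℝ} {xs ys : ℝ}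
  {p q : ℕ → ℝ × ℝ} {b : ℕ → ℝ}

/-- The product of the factors of the first component along the passage. -/
noncomputable def prodA (A B : ℝ → ℝ) (p : ℕ → ℝ × ℝ) (k : ℕ) : ℝ :=
  orbitProd (resFactor A) (resProduct A B) k ((p k).1 * (p k).2)

/-- The product of the factors of the second component along the passage. -/
noncomputable def prodB (A B : ℝ → ℝ) (p : ℕ → ℝ × ℝ) (k : ℕ) : ℝ :=
  orbitProd (resFactor B) (resProduct A B) k ((p k).1 * (p k).2)

/-- The deviation of the arrival point, in units of `√k * lam ^ k`. -/
noncomputable def scaledDev (lam ys : ℝ) (q : ℕ → ℝ × ℝ) (k : ℕ) : ℝ :=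
  ((q k).2 - ys) / (√(k : ℝ) * lam ^ k)

variable (H : SingleRoundPassage l lam A B F xs ys p q b)
include H

theorem diff_A : Differentiable ℝ (resFactor A) :=
  (contDiff_resFactor H.smooth_A).differentiable (by simp)

theorem diff_B : Differentiable ℝ (resFactor B) :=
  (contDiff_resFactor H.smooth_B).differentiable (by simp)

theorem tendsto_p1 : Tendsto (fun k => (p k).1) l (𝓝 xs) :=
  (continuous_fst.tendsto _).comp H.tendsto_p

theorem tendsto_q2 : Tendsto (fun k => (q k).2) l (𝓝 ys) :=
  (continuous_snd.tendsto _).comp H.tendsto_q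

theorem tendsto_prodA : Tendsto (prodA A B p) l (𝓝 1) := by
  have h := (tendsto_orbitProd (l := l) (h0 := fun k => (p k).1 * (p k).2) (H.diff_A 0)
    (by simp [resFactor]) H.bound H.tendsto_b H.tendsto_kb).comp (tendsto_diag_triangleFilter l)
  simp only [Function.comp_def] at h
  exact h

theorem tendsto_prodB : Tendsto (prodB A B p) l (𝓝 1) := by
  have h := (tendsto_orbitProd (l := l) (h0 := fun k => (p k).1 * (p k).2) (H.diff_B 0)
    (by simp [resFactor]) H.bound H.tendsto_b H.tendsto_kb).comp (tendsto_diag_triangleFilter l)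
  simp only [Function.comp_def] at h
  exact h

theorem q1_eq : ∀ᶠ k in l, (q k).1 = lam ^ k * (p k).1 * prodA A B p k := by
  filter_upwards [H.q_eq] with k hk
  rw [hk, ← Prod.mk.eta (p := p k), (iterate_resonantNormalForm H.lam_ne A B k _ _).1]
  rfl

theorem q2_eq : ∀ᶠ k in l, (q k).2 = (1 / lam) ^ k * (p k).2 * prodB A B p k := by
  filter_upwards [H.q_eq] with k hk
  rw [hk, ← Prod.mk.eta (p := p k), (iterate_resonantNormalForm H.lam_ne A B k _ _).1]
  rfl

theorem p2_eq : ∀ᶠ k in l, (p k).2 = lam ^ k * (q k).2 / prodB A B p k := by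
  have hlam := H.lam_ne
  filter_upwards [H.q2_eq, H.tendsto_prodB.eventually_ne one_ne_zero] with k hk hne
  rw [hk, one_div, inv_pow]
  field_simp

theorem tendsto_h_div : Tendsto (fun r : ℕ × ℕ =>
    (resProduct A B)^[r.2] ((p r.1).1 * (p r.1).2) / lam ^ r.1) (triangleFilter l)
    (𝓝 (xs * ys)) :=
  tendsto_iterate_resProduct_div (x0 := fun k => (p k).1) (y0 := fun k => (p k).2) H.lam_ne
    (H.diff_A 0) (H.diff_B 0) H.tendsto_p1 H.tendsto_q2 H.q2_eq H.bound H.tendsto_b H.tendsto_kb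

theorem tendsto_prodA_sub_one_div :
    Tendsto (fun k : ℕ => (prodA A B p k - 1) / (k * lam ^ k)) l (𝓝 (xs * ys * A 0)) :=
  tendsto_orbitProd_resFactor_sub_one_div H.le_atTop (h0 := fun k => (p k).1 * (p k).2)
    (H.diff_A 0) H.smooth_A.continuous.continuousAt
    H.bound H.tendsto_b H.tendsto_kb H.tendsto_h_div

theorem tendsto_prodB_sub_one_div :
    Tendsto (fun k : ℕ => (prodB A B p k - 1) / (k * lam ^ k)) l (𝓝 (xs * ys * B 0)) :=
  tendsto_orbitProd_resFactor_sub_one_div H.le_atTop (h0 := fun k => (p k).1 * (p k).2)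
    (H.diff_B 0) H.smooth_B.continuous.continuousAt
    H.bound H.tendsto_b H.tendsto_kb H.tendsto_h_div

theorem tendsto_sqrt_atTop : Tendsto (fun k : ℕ => √(k : ℝ)) l atTop :=
  Real.tendsto_sqrt_atTop.comp (tendsto_natCast_atTop_atTop.mono_left H.le_atTop)

theorem q2_sub_eq : ∀ᶠ k in l, (q k).2 - ys = √(k : ℝ) * lam ^ k * scaledDev lam ys q k := by
  filter_upwards [H.tendsto_sqrt_atTop.eventually_gt_atTop 0] with k hk
  have := pow_ne_zero k H.lam_ne
  rw [scaledDev]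
  field_simp

/-- The distance of the arrival point from the homoclinic point. -/
theorem norm_q_sub_le : ∀ᶠ k in l, ‖q k - (0, ys)‖ ≤
    |lam| ^ k * √(k : ℝ) * ((|xs| + 2) * (1 + scaledDev lam ys q k ^ 2)) := by
  have h1 : Tendsto (fun k => |(p k).1 * prodA A B p k|) l (𝓝 |xs|) := by
    simpa using (H.tendsto_p1.mul H.tendsto_prodA).abs
  filter_upwards [H.q1_eq, H.q2_sub_eq, h1.eventually (gt_mem_nhds (lt_add_one _)),
    H.tendsto_sqrt_atTop.eventually_ge_atTop 1] with k hq1 hq2 hb hk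
  set v := scaledDev lam ys q k
  -- Boundedness of `v` is not yet known; this puts the estimate in the form that `tendsto_sq_of_eq`
  -- absorbs.
  have hv : |v| ≤ 1 + v ^ 2 := by
    nlinarith [sq_nonneg (|v| - 1), sq_abs v, abs_nonneg v]
  have hL : 0 ≤ |lam| ^ k := by positivity
  have h2 : ‖q k - (0, ys)‖ ≤ |(q k).1| + |(q k).2 - ys| := by
    rw [Prod.norm_def]
    simp only [Prod.fst_sub, Prod.snd_sub, sub_zero, Real.norm_eq_abs]
    exact max_le_add_of_nonneg (abs_nonneg _) (abs_nonneg _)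
  have h3 : |(q k).1| ≤ |lam| ^ k * √(k : ℝ) * ((|xs| + 1) * (1 + v ^ 2)) := by
    rw [hq1, mul_assoc, abs_mul, abs_pow, mul_assoc]
    refine mul_le_mul_of_nonneg_left ?_ hL
    calc _ ≤ 1 * ((|xs| + 1) * 1) := by linarith
      _ ≤ _ := by gcongr; nlinarith
  have h4 : |(q k).2 - ys| ≤ |lam| ^ k * √(k : ℝ) * (1 + v ^ 2) := by
    rw [hq2, abs_mul, abs_mul, abs_pow, abs_of_nonneg (Real.sqrt_nonneg _), mul_comm (√(k : ℝ))]
    gcongr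
  calc _ ≤ _ := h2
    _ ≤ |lam| ^ k * √(k : ℝ) * ((|xs| + 1) * (1 + v ^ 2)) +
        |lam| ^ k * √(k : ℝ) * (1 + v ^ 2) := add_le_add h3 h4
    _ = _ := by ring

/-- The second component of `F (q k) = p k`, divided by `k * lam ^ (2 * k)`: `hd1` cancels the
leading order and `hd2` removes the linear term, leaving the quadratic one to balance the drift of
the products. -/
theorem tendsto_scaledDev_sq (hxs : xs ≠ 0) (hF : F (0, ys) = (xs, 0))
    (hd1 : (fderiv ℝ F (0, ys) (1, 0)).2 = ys / xs) (hd2 : (fderiv ℝ F (0, ys) (0, 1)).2 = 0)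
    (hd5 : iteratedDeriv 2 (fun y : ℝ => (F (0, y)).2) ys / 2 ≠ 0) :
    Tendsto (fun k => scaledDev lam ys q k ^ 2) l
      (𝓝 (-((A 0 + B 0) * xs * ys ^ 2) /
        (iteratedDeriv 2 (fun y : ℝ => (F (0, y)).2) ys / 2))) := by
  obtain ⟨C, hC, φ, hφ, hexp⟩ := exists_snd_expansion H.smooth_F (ys := ys) (by rw [hF]) hd2
  obtain ⟨C', hC', hlip⟩ :=
    (H.smooth_F.differentiable (by simp) (0, ys)).hasFDerivAt.isBigO_sub.exists_pos
  rw [hd1] at hexp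
  set d5 := iteratedDeriv 2 (fun y : ℝ => (F (0, y)).2) ys / 2 with hd5def
  set v := scaledDev lam ys q
  set e : ℕ → ℝ := fun k => (p k).2 - (ys / xs * (q k).1 + (d5 + φ (q k).2) * ((q k).2 - ys) ^ 2)
    with he
  have hexpk : ∀ᶠ k in l, |e k| ≤ C * |(q k).1| * ‖q k - (0, ys)‖ := by
    filter_upwards [H.tendsto_q.eventually hexp, H.map_q] with k hk hm
    rw [hm] at hk
    exact hk
  have hlipk : ∀ᶠ k in l, |(p k).1 - xs| ≤ C' * ‖q k - (0, ys)‖ := by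
    filter_upwards [H.tendsto_q.eventually hlip.bound, H.map_q] with k hk hm
    rw [hm, hF] at hk
    refine le_trans ?_ hk
    simpa using norm_fst_le (p k - (xs, (0 : ℝ)))
  -- `w` carries the drift of the two products; `r` collects the displacements of the endpoints and
  -- the Taylor error `e`, and is `O((1 + v²) / √k)`.
  set r : ℕ → ℝ := fun k => ((q k).2 - ys - ys / xs * ((p k).1 - xs)) / (k * lam ^ k) -
    e k / (k * (lam ^ k) ^ 2) with hr
  set w : ℕ → ℝ := fun k => -((q k).2 / prodB A B p k * ((prodB A B p k - 1) / (k * lam ^ k))) -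
    ys / xs * (p k).1 * ((prodA A B p k - 1) / (k * lam ^ k)) with hw
  set D : ℝ := (1 + |ys / xs| * C' + C * (|xs| + 1)) * (|xs| + 2) with hD
  refine tendsto_sq_of_eq (φ := fun k => d5 + φ (q k).2) (w := w) (r := r)
    (δ := fun k : ℕ => D * (√(k : ℝ))⁻¹) hd5 ?_ ?_ ?_ ?_ ?_
  · simpa using (hφ.comp H.tendsto_q2).const_add d5
  · have h1 : Tendsto w l (𝓝 _) := (((H.tendsto_q2.div H.tendsto_prodB one_ne_zero).mul
      H.tendsto_prodB_sub_one_div).neg).sub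
      ((H.tendsto_p1.const_mul (ys / xs)).mul H.tendsto_prodA_sub_one_div)
    convert h1 using 2
    rw [div_one, div_mul_cancel₀ _ hxs]
    ring
  · simpa using (H.tendsto_sqrt_atTop.inv_tendsto_atTop).const_mul D
  · have h1 : Tendsto (fun k => |(p k).1 * prodA A B p k|) l (𝓝 |xs|) := by
      simpa using (H.tendsto_p1.mul H.tendsto_prodA).abs
    filter_upwards [hexpk, hlipk, H.q1_eq, H.norm_q_sub_le,
      h1.eventually (gt_mem_nhds (lt_add_one _)),
      H.tendsto_sqrt_atTop.eventually_gt_atTop 0] with k he1 hl1 hq1 hn hb hs0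
    set ρ := ‖q k - (0, ys)‖ with hρ
    have hρ0 : 0 ≤ ρ := norm_nonneg _
    set Λ := |lam| ^ k with hΛ
    have hΛ0 : 0 < Λ := pow_pos (abs_pos.2 H.lam_ne) k
    have hk0 : (0 : ℝ) < k := Real.sqrt_pos.1 hs0
    have hsq : √(k : ℝ) * √(k : ℝ) = k := Real.mul_self_sqrt hk0.le
    have hu : |(q k).2 - ys| ≤ ρ := by
      simpa using norm_snd_le (q k - ((0 : ℝ), ys))
    have hq1' : |(q k).1| ≤ Λ * (|xs| + 1) := by
      rw [hq1, mul_assoc, abs_mul, abs_pow]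
      gcongr
    have hr1 : |((q k).2 - ys - ys / xs * ((p k).1 - xs)) / (k * lam ^ k)| ≤
        (1 + |ys / xs| * C') * ρ / (k * Λ) := by
      rw [abs_div, abs_mul (k : ℝ), abs_pow, abs_of_pos hk0]
      refine div_le_div_of_nonneg_right ?_ (by positivity)
      refine (abs_sub _ _).trans ?_
      rw [abs_mul]
      calc _ ≤ ρ + |ys / xs| * (C' * ρ) := by gcongr
        _ = _ := by ring
    have hr2 : |e k / (k * (lam ^ k) ^ 2)| ≤ C * (|xs| + 1) * ρ / (k * Λ) := by
      rw [abs_div, abs_mul (k : ℝ), abs_pow, abs_pow, abs_of_pos hk0, div_le_div_iff₀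
        (by positivity) (by positivity)]
      calc |e k| * (k * Λ) ≤ C * (Λ * (|xs| + 1)) * ρ * (k * Λ) := by
            gcongr
            exact he1.trans (by gcongr)
        _ = _ := by ring
    calc |r k| ≤ (1 + |ys / xs| * C') * ρ / (k * Λ) + C * (|xs| + 1) * ρ / (k * Λ) :=
          (abs_sub _ _).trans (add_le_add hr1 hr2)
      _ = (1 + |ys / xs| * C' + C * (|xs| + 1)) * (ρ / (k * Λ)) := by ring
      _ ≤ (1 + |ys / xs| * C' + C * (|xs| + 1)) *
          ((Λ * √(k : ℝ) * ((|xs| + 2) * (1 + v k ^ 2))) / (k * Λ)) := by gcongr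
      _ = D * (√(k : ℝ))⁻¹ * (1 + v k ^ 2) := by
          rw [hD]
          nth_rewrite 2 [← hsq]
          field_simp
  · filter_upwards [H.q1_eq, H.p2_eq, H.q2_sub_eq, H.tendsto_prodB.eventually_ne one_ne_zero,
      H.tendsto_sqrt_atTop.eventually_gt_atTop 0] with k hq1 hp2 hq2 hne hs0
    have hk0 : (0 : ℝ) < k := Real.sqrt_pos.1 hs0
    have hsq : √(k : ℝ) ^ 2 = k := Real.sq_sqrt hk0.le
    have hΛ : lam ^ k ≠ 0 := pow_ne_zero k H.lam_ne
    have h1 : v k ^ 2 * (d5 + φ (q k).2) =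
        (d5 + φ (q k).2) * ((q k).2 - ys) ^ 2 / (k * (lam ^ k) ^ 2) := by
      rw [hq2, mul_pow, mul_pow, hsq]
      field_simp
      exact mul_comm _ _
    have h2 : (d5 + φ (q k).2) * ((q k).2 - ys) ^ 2 =
        lam ^ k * (q k).2 / prodB A B p k - ys / xs * (lam ^ k * (p k).1 * prodA A B p k) - e k := by
      rw [← hp2, ← hq1, he]
      ring
    rw [h1, h2, hw, hr]
    field_simp
    ring

end SingleRoundPassage

/-! ### Derivative of the passage and trace of the return map -/

theorem deriv_resProduct_zero {A B : ℝ → ℝ} (hA : ContDiff ℝ ∞ A) (hB : ContDiff ℝ ∞ B) :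
    deriv (resProduct A B) 0 = 1 := by
  have hA' := ((contDiff_resFactor hA).differentiable (by simp) 0).hasDerivAt
  have hB' := ((contDiff_resFactor hB).differentiable (by simp) 0).hasDerivAt
  have h := ((hasDerivAt_id (0 : ℝ)).mul hA').mul hB'
  have h2 : HasDerivAt (resProduct A B) _ 0 := h
  rw [h2.deriv]
  simp [resFactor]

namespace SingleRoundPassage

variable {l : Filter ℕ} {lam : ℝ} {A B : ℝ → ℝ} {F : ℝ × ℝ → ℝ × ℝ} {xs ys : ℝ}
  {p q : ℕ → ℝ × ℝ} {b : ℕ → ℝ}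

/-- The logarithmic derivative of `prodA` along the passage. -/
noncomputable def logA (A B : ℝ → ℝ) (p : ℕ → ℝ × ℝ) (k : ℕ) : ℝ :=
  orbitLogDeriv (resFactor A) (resProduct A B) k ((p k).1 * (p k).2)

/-- The logarithmic derivative of `prodB` along the passage. -/
noncomputable def logB (A B : ℝ → ℝ) (p : ℕ → ℝ × ℝ) (k : ℕ) : ℝ :=
  orbitLogDeriv (resFactor B) (resProduct A B) k ((p k).1 * (p k).2)

variable (H : SingleRoundPassage l lam A B F xs ys p q b)
include H

theorem tendsto_logDeriv_div {a : ℝ → ℝ} (ha : ContDiff ℝ ∞ a) (ha0 : a 0 = 1) :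
    Tendsto (fun k : ℕ => orbitLogDeriv a (resProduct A B) k ((p k).1 * (p k).2) / k) l
      (𝓝 (deriv a 0)) :=
  tendsto_orbitLogDeriv_div H.le_atTop (h0 := fun k => (p k).1 * (p k).2)
    (ha.differentiable (by simp) 0) ha0 (ha.continuous_deriv (by simp)).continuousAt
    ((contDiff_infty_iff_deriv.1 (contDiff_resProduct H.smooth_A H.smooth_B)).2.differentiable
      (by simp) 0)
    (deriv_resProduct_zero H.smooth_A H.smooth_B) H.bound H.tendsto_b H.tendsto_kb

theorem tendsto_logA_div : Tendsto (fun k : ℕ => logA A B p k / k) l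
    (𝓝 (deriv (resFactor A) 0)) :=
  H.tendsto_logDeriv_div (contDiff_resFactor H.smooth_A) (by simp [resFactor])

theorem tendsto_logB_div : Tendsto (fun k : ℕ => logB A B p k / k) l
    (𝓝 (deriv (resFactor B) 0)) :=
  H.tendsto_logDeriv_div (contDiff_resFactor H.smooth_B) (by simp [resFactor])

theorem eventually_factor_ne {a : ℝ → ℝ} (ha : ContinuousAt a 0) (ha0 : a 0 ≠ 0) :
    ∀ᶠ k in l, ∀ i < k, a ((resProduct A B)^[i] ((p k).1 * (p k).2)) ≠ 0 := by
  have h1 := tendsto_iterate_zero (h0 := fun k => (p k).1 * (p k).2) H.bound H.tendsto_b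
  have h2 := eventually_triangleFilter.1 ((ha.tendsto.comp h1).eventually_ne ha0)
  filter_upwards [h2] with k hk i hi using hk i hi.le

/-- The entries of the derivative of the passage map. -/
theorem fderiv_passage : ∀ᶠ k in l,
    fderiv ℝ ((resonantNormalForm lam A B)^[k]) (p k) (1, 0) =
        (lam ^ k * (prodA A B p k + (p k).1 * (p k).2 * (prodA A B p k * logA A B p k)),
          (1 / lam) ^ k * ((p k).2 ^ 2 * (prodB A B p k * logB A B p k))) ∧
      fderiv ℝ ((resonantNormalForm lam A B)^[k]) (p k) (0, 1) =
        (lam ^ k * ((p k).1 ^ 2 * (prodA A B p k * logA A B p k)),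
          (1 / lam) ^ k *
            (prodB A B p k + (p k).1 * (p k).2 * (prodB A B p k * logB A B p k))) := by
  have hg := (contDiff_resProduct H.smooth_A H.smooth_B).differentiable (by simp)
  filter_upwards [H.eventually_factor_ne (H.diff_A 0).continuousAt (by simp [resFactor]),
    H.eventually_factor_ne (H.diff_B 0).continuousAt (by simp [resFactor])] with k hkA hkB
  exact fderiv_iterate_resonantNormalForm H.lam_ne H.smooth_A H.smooth_B k (p k).1 (p k).2
    (prodA A B p k) (prodB A B p k) _ _ rfl rfl
    (hasDerivAt_orbitProd H.diff_A hg k _ hkA) (hasDerivAt_orbitProd H.diff_B hg k _ hkB)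

theorem tendsto_k_mul_pow : Tendsto (fun k : ℕ => (k : ℝ) * lam ^ k) l (𝓝 0) :=
  (tendsto_self_mul_const_pow_of_abs_lt_one H.lam_lt).mono_left H.le_atTop

theorem eventually_cast_ne : ∀ᶠ k : ℕ in l, (k : ℝ) ≠ 0 := by
  filter_upwards [H.le_atTop (eventually_gt_atTop 0)] with k hk
  exact Nat.cast_ne_zero.2 hk.ne'

theorem tendsto_k_mul_h : Tendsto (fun k : ℕ => (k : ℝ) * ((p k).1 * (p k).2)) l (𝓝 0) := by
  refine squeeze_zero_norm' ?_ H.tendsto_kb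
  filter_upwards [H.bound] with k hk
  have h := hk 0 (Nat.zero_le k)
  rw [Real.norm_eq_abs, abs_mul, Nat.abs_cast]
  exact mul_le_mul_of_nonneg_left h (Nat.cast_nonneg k)

theorem tendsto_h_logA : Tendsto
    (fun k => (p k).1 * (p k).2 * (prodA A B p k * logA A B p k)) l (𝓝 0) := by
  have h := H.tendsto_k_mul_h.mul (H.tendsto_prodA.mul H.tendsto_logA_div)
  rw [zero_mul] at h
  refine h.congr' ?_
  filter_upwards [H.eventually_cast_ne] with k hk
  field_simp

theorem tendsto_h_logB : Tendsto
    (fun k => (p k).1 * (p k).2 * (prodB A B p k * logB A B p k)) l (𝓝 0) := by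
  have h := H.tendsto_k_mul_h.mul (H.tendsto_prodB.mul H.tendsto_logB_div)
  rw [zero_mul] at h
  refine h.congr' ?_
  filter_upwards [H.eventually_cast_ne] with k hk
  field_simp

theorem tendsto_passage_fst_fst :
    Tendsto (fun k => (fderiv ℝ ((resonantNormalForm lam A B)^[k]) (p k) (1, 0)).1) l (𝓝 0) := by
  have h1 : Tendsto (fun k : ℕ => lam ^ k) l (𝓝 0) :=
    (tendsto_pow_atTop_nhds_zero_of_abs_lt_one H.lam_lt).mono_left H.le_atTop
  have h := h1.mul (H.tendsto_prodA.add H.tendsto_h_logA)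
  rw [zero_mul] at h
  refine h.congr' ?_
  filter_upwards [H.fderiv_passage] with k hk
  rw [hk.1]

theorem tendsto_passage_fst_snd :
    Tendsto (fun k => (fderiv ℝ ((resonantNormalForm lam A B)^[k]) (p k) (0, 1)).1) l (𝓝 0) := by
  have h := H.tendsto_k_mul_pow.mul ((H.tendsto_p1.pow 2).mul
    (H.tendsto_prodA.mul H.tendsto_logA_div))
  rw [zero_mul] at h
  refine h.congr' ?_
  filter_upwards [H.fderiv_passage, H.eventually_cast_ne] with k hk hk0
  rw [hk.2]
  field_simp

/-- The expansion `lam⁻¹ ^ k` is outweighed by `(p k).2 ^ 2`, of order `lam ^ (2 * k)`; the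
logarithmic derivative contributes a factor of order at most `k`. -/
theorem tendsto_passage_snd_fst :
    Tendsto (fun k => (fderiv ℝ ((resonantNormalForm lam A B)^[k]) (p k) (1, 0)).2) l (𝓝 0) := by
  have hlam := H.lam_ne
  have h := H.tendsto_k_mul_pow.mul (((H.tendsto_q2.pow 2).div H.tendsto_prodB one_ne_zero).mul
    H.tendsto_logB_div)
  rw [zero_mul] at h
  refine h.congr' ?_
  filter_upwards [H.fderiv_passage, H.eventually_cast_ne, H.p2_eq,
    H.tendsto_prodB.eventually_ne one_ne_zero] with k hk hk0 hp2 hne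
  rw [hk.1, hp2]
  simp only [Pi.div_apply, one_div, inv_pow]
  field_simp

theorem tendsto_lam_passage_snd_snd :
    Tendsto (fun k => lam ^ k * (fderiv ℝ ((resonantNormalForm lam A B)^[k]) (p k) (0, 1)).2) l
      (𝓝 1) := by
  have hlam := H.lam_ne
  have h := H.tendsto_prodB.add H.tendsto_h_logB
  rw [add_zero] at h
  refine h.congr' ?_
  filter_upwards [H.fderiv_passage] with k hk
  rw [hk.2]
  simp only [one_div, inv_pow]
  field_simp

/-- The powers of `lam` cancel in the determinant, and every term with a logarithmic derivative
carries a factor `h` with `k * h → 0`. -/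
theorem tendsto_entryDet_passage :
    Tendsto (fun k => entryDet (fderiv ℝ ((resonantNormalForm lam A B)^[k]) (p k))) l (𝓝 1) := by
  have hlam := H.lam_ne
  have h := ((H.tendsto_prodA.add H.tendsto_h_logA).mul (H.tendsto_prodB.add H.tendsto_h_logB)).sub
    (H.tendsto_h_logA.mul H.tendsto_h_logB)
  rw [add_zero, mul_one, mul_zero, sub_zero] at h
  refine h.congr' ?_
  filter_upwards [H.fderiv_passage] with k hk
  rw [entryDet, hk.1, hk.2]
  simp only [one_div, inv_pow]
  field_simp

theorem tendsto_fderiv_global (v : ℝ × ℝ) :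
    Tendsto (fun k => fderiv ℝ F (q k) v) l (𝓝 (fderiv ℝ F (0, ys) v)) := by
  have h : Continuous (fun r => fderiv ℝ F r v) :=
    (H.smooth_F.continuous_fderiv (by simp)).clm_apply continuous_const
  exact (h.tendsto _).comp H.tendsto_q

theorem tendsto_entryDet_global :
    Tendsto (fun k => entryDet (fderiv ℝ F (q k))) l (𝓝 (entryDet (fderiv ℝ F (0, ys)))) := by
  have h1 := H.tendsto_fderiv_global (1, 0)
  have h2 := H.tendsto_fderiv_global (0, 1)
  have f1 := (continuous_fst.tendsto _).comp h1
  have f2 := (continuous_snd.tendsto _).comp h1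
  have g1 := (continuous_fst.tendsto _).comp h2
  have g2 := (continuous_snd.tendsto _).comp h2
  exact (f1.mul g2).sub (g1.mul f2)

/-- The growth of the trace of the derivative of the return map. -/
theorem tendsto_abs_trace_div {ζ c : ℝ}
    (hζ : Tendsto (fun k => scaledDev lam ys q k ^ 2) l (𝓝 (ζ ^ 2)))
    (hc : iteratedDeriv 2 (fun y : ℝ => (F (0, y)).2) ys = c)
    (hd2 : (fderiv ℝ F (0, ys) (0, 1)).2 = 0) :
    Tendsto (fun k : ℕ =>
      |((fderiv ℝ ((resonantNormalForm lam A B)^[k]) (p k)).comp (fderiv ℝ F (q k)) (1, 0)).1 +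
        ((fderiv ℝ ((resonantNormalForm lam A B)^[k]) (p k)).comp (fderiv ℝ F (q k)) (0, 1)).2| /
        √(k : ℝ)) l (𝓝 |c * ζ|) := by
  obtain ⟨C, hC, φ, hφ, hexp⟩ := exists_fderiv_snd_expansion H.smooth_F hd2
  rw [hc] at hexp
  set M : ℕ → (ℝ × ℝ →L[ℝ] ℝ × ℝ) :=
    fun k => fderiv ℝ ((resonantNormalForm lam A B)^[k]) (p k) with hM
  set G : ℕ → (ℝ × ℝ →L[ℝ] ℝ × ℝ) := fun k => fderiv ℝ F (q k) with hG
  set v := scaledDev lam ys q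
  have hinv : Tendsto (fun k : ℕ => (√(k : ℝ))⁻¹) l (𝓝 0) :=
    H.tendsto_sqrt_atTop.inv_tendsto_atTop
  have hvabs : Tendsto (fun k => |v k|) l (𝓝 |ζ|) := by
    have h := (Real.continuous_sqrt.tendsto _).comp hζ
    simpa only [Function.comp_def, Real.sqrt_sq_eq_abs] using h
  have hG1 : Tendsto (fun k => G k (1, 0)) l (𝓝 _) := H.tendsto_fderiv_global (1, 0)
  have hG2 : Tendsto (fun k => G k (0, 1)) l (𝓝 _) := H.tendsto_fderiv_global (0, 1)
  have hbdd : Tendsto (fun k => (M k (1, 0)).1 * (G k (1, 0)).1 + (M k (0, 1)).1 * (G k (1, 0)).2 +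
      (M k (1, 0)).2 * (G k (0, 1)).1) l (𝓝 0) := by
    have h := ((H.tendsto_passage_fst_fst.mul ((continuous_fst.tendsto _).comp hG1)).add
      (H.tendsto_passage_fst_snd.mul ((continuous_snd.tendsto _).comp hG1))).add
      (H.tendsto_passage_snd_fst.mul ((continuous_fst.tendsto _).comp hG2))
    simp only [zero_mul, add_zero] at h
    exact h
  set e : ℕ → ℝ := fun k => (G k (0, 1)).2 - (c + φ (q k).2) * ((q k).2 - ys) with he
  have hebd : ∀ᶠ k in l, |e k| ≤ C * |(q k).1| := H.tendsto_q.eventually hexp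
  -- The error is `O(lam ^ k)`: after the expansion it remains bounded, hence negligible against
  -- `√k`.
  have he0 : Tendsto (fun k : ℕ => (√(k : ℝ))⁻¹ * (e k / lam ^ k)) l (𝓝 0) := by
    have h1 : Tendsto (fun k => C * |(p k).1 * prodA A B p k|) l (𝓝 (C * |xs * 1|)) :=
      ((H.tendsto_p1.mul H.tendsto_prodA).abs).const_mul C
    have h2 := hinv.mul h1
    rw [zero_mul] at h2
    refine squeeze_zero_norm' ?_ h2
    filter_upwards [hebd, H.q1_eq] with k hk hq1
    have hΛ : 0 < |lam ^ k| := abs_pos.2 (pow_ne_zero k H.lam_ne)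
    rw [Real.norm_eq_abs, abs_mul, abs_of_nonneg (inv_nonneg.2 (Real.sqrt_nonneg _)), abs_div]
    refine mul_le_mul_of_nonneg_left ?_ (inv_nonneg.2 (Real.sqrt_nonneg _))
    rw [div_le_iff₀ hΛ]
    refine hk.trans (le_of_eq ?_)
    rw [hq1, mul_assoc, abs_mul]
    ring
  have hmain : Tendsto (fun k => |lam ^ k * (M k (0, 1)).2 * (c + φ (q k).2)| * |v k|) l
      (𝓝 (|c| * |ζ|)) := by
    have h := ((H.tendsto_lam_passage_snd_snd.mul
      ((hφ.comp H.tendsto_q2).const_add c)).abs).mul hvabs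
    simp only [one_mul, add_zero] at h
    exact h
  have herr : Tendsto (fun k : ℕ => (√(k : ℝ))⁻¹ * ((M k (1, 0)).1 * (G k (1, 0)).1 +
      (M k (0, 1)).1 * (G k (1, 0)).2 + (M k (1, 0)).2 * (G k (0, 1)).1) +
      lam ^ k * (M k (0, 1)).2 * ((√(k : ℝ))⁻¹ * (e k / lam ^ k))) l (𝓝 0) := by
    have h := (hinv.mul hbdd).add (H.tendsto_lam_passage_snd_snd.mul he0)
    simpa only [mul_zero, add_zero] using h
  -- Only `|v k|` is known to converge, not `v k` itself, whose sign may vary; hence the squeeze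
  -- between absolute values.
  have hlow := hmain.sub herr.abs
  have hupp := hmain.add herr.abs
  rw [abs_zero, sub_zero] at hlow
  rw [abs_zero, add_zero] at hupp
  rw [abs_mul]
  have hkey : ∀ᶠ k : ℕ in l, ((M k).comp (G k) (1, 0)).1 + ((M k).comp (G k) (0, 1)).2 =
      √(k : ℝ) * (lam ^ k * (M k (0, 1)).2 * (c + φ (q k).2) * v k +
      ((√(k : ℝ))⁻¹ * ((M k (1, 0)).1 * (G k (1, 0)).1 +
      (M k (0, 1)).1 * (G k (1, 0)).2 + (M k (1, 0)).2 * (G k (0, 1)).1) +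
      lam ^ k * (M k (0, 1)).2 * ((√(k : ℝ))⁻¹ * (e k / lam ^ k)))) := by
    filter_upwards [H.q2_sub_eq, H.tendsto_sqrt_atTop.eventually_gt_atTop 0] with k hq2 hs
    have hΛ : lam ^ k ≠ 0 := pow_ne_zero k H.lam_ne
    have hek : (G k (0, 1)).2 = (c + φ (q k).2) * (√(k : ℝ) * lam ^ k * v k) + e k := by
      rw [he, ← hq2]; ring
    rw [entryTrace_comp, hek]
    field_simp
    ring
  refine tendsto_of_tendsto_of_tendsto_of_le_of_le' hlow hupp ?_ ?_
  · filter_upwards [hkey, H.tendsto_sqrt_atTop.eventually_gt_atTop 0] with k hk hs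
    rw [hk, abs_mul (√(k : ℝ)), abs_of_pos hs, mul_div_cancel_left₀ _ hs.ne', ← abs_mul]
    have := abs_sub_abs_le_abs_sub (lam ^ k * (M k (0, 1)).2 * (c + φ (q k).2) * v k)
      (-((√(k : ℝ))⁻¹ * ((M k (1, 0)).1 * (G k (1, 0)).1 +
      (M k (0, 1)).1 * (G k (1, 0)).2 + (M k (1, 0)).2 * (G k (0, 1)).1) +
      lam ^ k * (M k (0, 1)).2 * ((√(k : ℝ))⁻¹ * (e k / lam ^ k))))
    rwa [abs_neg, sub_neg_eq_add] at this
  · filter_upwards [hkey, H.tendsto_sqrt_atTop.eventually_gt_atTop 0] with k hk hs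
    rw [hk, abs_mul (√(k : ℝ)), abs_of_pos hs, mul_div_cancel_left₀ _ hs.ne', ← abs_mul]
    exact abs_add_le _ _

end SingleRoundPassage

/-! ### Single-round solutions and the conclusion -/

/-- Near the axes, the normal form contracts the first coordinate and expands the second. -/
theorem exists_hyperbolic_rate {lam : ℝ} (hlam1 : |lam| < 1) {A B : ℝ → ℝ} (hA : ContDiff ℝ ∞ A)
    (hB : ContDiff ℝ ∞ B) : ∃ μ η : ℝ, 0 ≤ μ ∧ μ < 1 ∧ 0 < η ∧ ∀ h, |h| < η →
      |lam * resFactor A h| ≤ μ ∧ |lam| ≤ μ * |resFactor B h| := by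
  -- Any rate strictly between `|lam|` and 1 would do; it leaves room for factors close to 1.
  set μ := (1 + |lam|) / 2 with hμ
  have hlt : |lam| < μ := by rw [hμ]; linarith
  have h1 : Tendsto (fun h => |lam * resFactor A h|) (𝓝 0) (𝓝 |lam|) := by
    have := ((contDiff_resFactor hA).continuous.tendsto 0).const_mul lam
    simpa [resFactor] using this.abs
  have h2 : Tendsto (fun h => μ * |resFactor B h|) (𝓝 0) (𝓝 μ) := by
    have := (((contDiff_resFactor hB).continuous.tendsto 0).abs).const_mul μ
    simpa [resFactor] using this
  obtain ⟨η, hη, H⟩ := Metric.eventually_nhds_iff.1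
    ((h1.eventually (ge_mem_nhds hlt)).and (h2.eventually (le_mem_nhds hlt)))
  refine ⟨μ, η, ?_, by rw [hμ]; linarith, hη, fun h hh => H (by simpa using hh)⟩
  have := abs_nonneg lam
  positivity

section SRSolution

variable {f : ℝ × ℝ → ℝ × ℝ} {lam : ℝ} {A B : ℝ → ℝ} {N : Set (ℝ × ℝ)} {m k : ℕ} {η : ℝ}
  {z : ℝ × ℝ}

theorem IsSRSolution.abs_iterate_resProduct_le (hfN : ∀ p ∈ N, f p = resonantNormalForm lam A B p)
    (hlam : lam ≠ 0) {μ : ℝ} (hμ : 0 ≤ μ)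
    (hrate : ∀ h, |h| < η → |lam * resFactor A h| ≤ μ ∧ |lam| ≤ μ * |resFactor B h|)
    (hz : IsSRSolution f m N η k z) {j : ℕ} (hj : j ≤ k) :
    |(resProduct A B)^[j] (z.1 * z.2)| ≤ μ ^ k * (|z.1| * |(f^[k] z).2|) := by
  have hit : ∀ i ≤ k, f^[i] z = (resonantNormalForm lam A B)^[i] z := by
    intro i
    induction i with
    | zero => simp
    | succ i ih =>
      intro hi
      rw [Function.iterate_succ_apply', Function.iterate_succ_apply', ← ih (Nat.le_of_succ_le hi),
        hfN _ (hz.2 i hi).1]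
  have hstep : ∀ i < k, f^[i + 1] z = resonantNormalForm lam A B (f^[i] z) := fun i hi => by
    rw [Function.iterate_succ_apply', hfN _ (hz.2 i hi).1]
  have hh := (iterate_resonantNormalForm hlam A B j z.1 z.2).2
  rw [← hh, Prod.mk.eta, ← hit j hj]
  exact abs_mul_le_of_hyperbolic hμ hlam (X := fun i => (f^[i] z).1) (Y := fun i => (f^[i] z).2)
    (a := fun i => resFactor A ((f^[i] z).1 * (f^[i] z).2))
    (b := fun i => resFactor B ((f^[i] z).1 * (f^[i] z).2))
    (fun i hi => by simp only [hstep i hi, resonantNormalForm_eq])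
    (fun i hi => by simp only [hstep i hi, resonantNormalForm_eq])
    (fun i hi => (hrate _ (hz.2 i hi).2).1) (fun i hi => (hrate _ (hz.2 i hi).2).2) hj

theorem IsSRSolution.iterate_iterate (hz : IsSRSolution f m N η k z) :
    f^[m] (f^[k] z) = z := by
  rw [← Function.iterate_add_apply, add_comm]
  exact hz.1

theorem IsSRSolution.returnTrace_eq (hf : ContDiff ℝ ∞ f) (hz : IsSRSolution f m N η k z) :
    returnTrace f m k z =
      ((fderiv ℝ (f^[k]) z).comp (fderiv ℝ (f^[m]) (f^[k] z)) (1, 0)).1 +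
        ((fderiv ℝ (f^[k]) z).comp (fderiv ℝ (f^[m]) (f^[k] z)) (0, 1)).2 := by
  have hdiff : ∀ n w, DifferentiableAt ℝ (f^[n]) w := fun n w =>
    (contDiff_iterate_endo hf n).differentiable (by simp) w
  rw [returnTrace, Function.iterate_add, fderiv_comp _ (hdiff _ _) (hdiff _ _),
    hz.iterate_iterate, trace_prod_eq]

/-- Stability is tested at `z`, whereas `returnTrace` is taken at `f^[k] z`; the two linearizations
are the same factors composed in opposite orders, so their traces agree. -/
theorem IsSRSolution.not_isLyapunovStable (hf : ContDiff ℝ ∞ f) (hz : IsSRSolution f m N η k z)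
    (hbig : |entryDet (fderiv ℝ (f^[m]) (f^[k] z)) * entryDet (fderiv ℝ (f^[k]) z)| + 3 ≤
      |returnTrace f m k z|) : ¬ IsLyapunovStable f z := by
  have hdiff : ∀ n w, DifferentiableAt ℝ (f^[n]) w := fun n w =>
    (contDiff_iterate_endo hf n).differentiable (by simp) w
  intro hst
  have hL : HasFDerivAt (f^[k + m])
      ((fderiv ℝ (f^[m]) (f^[k] z)).comp (fderiv ℝ (f^[k]) z)) z := by
    rw [add_comm, Function.iterate_add]
    exact (hdiff m _).hasFDerivAt.comp z (hdiff k z).hasFDerivAt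
  refine not_isLyapunovStable_of_trace hL hz.1 ?_ (hst.iterate _)
  rw [entryDet_comp]
  refine hbig.trans (le_of_eq ?_)
  rw [hz.returnTrace_eq hf, entryTrace_comp, entryTrace_comp]
  congr 1
  ring

end SRSolution

theorem mainTheorem3
    (f : ℝ × ℝ → ℝ × ℝ) (hf : ContDiff ℝ ∞ f)
    (lam sig : ℝ) (hlam0 : 0 < |lam|) (hlam1 : |lam| < 1) (hsig : 1 < |sig|)
    (hres : lam * sig = 1)
    (A B : ℝ → ℝ) (hA : ContDiff ℝ ∞ A) (hB : ContDiff ℝ ∞ B)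
    (N : Set (ℝ × ℝ)) (hN0 : N ∈ 𝓝 (0 : ℝ × ℝ)) (hNb : Bornology.IsBounded N)
    (hNc : Convex ℝ N)
    (hfN : ∀ p ∈ N, f p = resonantNormalForm lam A B p)
    (xs ys : ℝ) (hxs : 0 < xs) (hys : 0 < ys)
    (hx0 : (xs, (0 : ℝ)) ∈ N) (hx1 : (lam * xs, (0 : ℝ)) ∈ N)
    (hy1 : ((0 : ℝ), ys / sig) ∈ N) (hy2 : ((0 : ℝ), ys / sig ^ 2) ∈ N)
    (m : ℕ) (hm : 1 ≤ m) (hhom : f^[m] (0, ys) = (xs, 0))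
    (hd1 : coeffD1 f m ys = ys / xs) (hd2 : coeffD2 f m ys = 0) (hd5 : coeffD5 f m ys ≠ 0) :
    ∃ η > 0, ∀ K : Set ℕ, K.Infinite → (∀ k ∈ K, 1 ≤ k) → ∀ z : ℕ → ℝ × ℝ,
      (∀ k ∈ K, IsSRSolution f m N η k (z k)) →
      Tendsto z (atTop ⊓ 𝓟 K) (𝓝 (xs, 0)) →
      ((∀ q, f^[m] q = (xs, 0) → q = (0, ys)) ∨
        SolutionsApproach f K z (homoclinicOrbit f sig ys)) →
      ((∀ k ∈ K, IsLyapunovStable f (z k)) → A 0 + B 0 = 0) ∧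
      (A 0 + B 0 ≠ 0 →
        ∃ ζ : ℝ, ζ ≠ 0 ∧ coeffD5 f m ys * ζ ^ 2 = -((A 0 + B 0) * xs * ys ^ 2) ∧
          Tendsto (fun k : ℕ => |returnTrace f m k (z k)| / √(k : ℝ)) (atTop ⊓ 𝓟 K)
            (𝓝 |2 * coeffD5 f m ys * ζ|)) := by
  obtain ⟨μ, η, hμ0, hμ1, hη, hrate⟩ := exists_hyperbolic_rate hlam1 hA hB
  refine ⟨η, hη, ?_⟩
  intro K hKinf hK1 z hz hzlim halt
  have hlam : lam ≠ 0 := abs_pos.1 hlam0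
  set l : Filter ℕ := atTop ⊓ 𝓟 K with hl
  have hltop : l ≤ atTop := inf_le_left
  have hne : l.NeBot := frequently_mem_iff_neBot.1 (Nat.frequently_atTop_iff_infinite.2 hKinf)
  have hKl : ∀ᶠ k in l, k ∈ K := mem_inf_of_right (mem_principal_self K)
  have hF : ContDiff ℝ ∞ (f^[m]) := contDiff_iterate_endo hf m
  set q : ℕ → ℝ × ℝ := fun k => f^[k] (z k) with hq
  have h0N : (0 : ℝ × ℝ) ∈ N := mem_of_mem_nhds hN0
  have hmapq : ∀ᶠ k in l, f^[m] (q k) = z k := hKl.mono fun k hk => (hz k hk).iterate_iterate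
  -- The arrival point itself need not lie in `N`, but its predecessor, with index `k - 1`, does;
  -- here `k ≥ 1` is used.
  have hqcpt : ∀ᶠ k in l, q k ∈ f '' closure N := by
    filter_upwards [hKl] with k hk
    obtain ⟨i, rfl⟩ := Nat.exists_eq_add_of_le' (hK1 k hk)
    refine ⟨f^[i] (z (i + 1)), subset_closure ((hz _ hk).2 i (Nat.lt_succ_self i)).1, ?_⟩
    rw [hq, ← Function.iterate_succ_apply' f]
  have hqlim : Tendsto q l (𝓝 (0, ys)) := by
    have hcpt : IsCompact (f '' closure N) := hNb.isCompact_closure.image hf.continuous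
    have hFq : Tendsto (fun k => f^[m] (q k)) l (𝓝 (xs, 0)) :=
      hzlim.congr' (hmapq.mono fun k hk => hk.symm)
    rcases halt with huniq | happ
    · exact tendsto_of_unique_cluster (S := Set.univ) hF.continuous hcpt hqcpt hFq
        (fun ε hε => Eventually.of_forall fun k => ⟨q k, trivial, by rwa [dist_self]⟩)
        (fun r _ hr => huniq r hr)
    · refine tendsto_of_unique_cluster (S := homoclinicOrbit f sig ys) hF.continuous hcpt hqcpt
        hFq (fun ε hε => ?_) (fun r hr hfr => eq_of_mem_closure_homoclinicOrbit hsig hres hlam1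
          hNc h0N hfN hxs.ne' hx0 hx1 hy1 hy2 hhom hr hfr)
      obtain ⟨k₀, hk₀⟩ := happ ε hε
      filter_upwards [hKl, hltop (eventually_ge_atTop k₀)] with k hk hkk using hk₀ k hk hkk k
  have hNint : (interior N).Nonempty := ⟨0, mem_interior_iff_mem_nhds.2 hN0⟩
  have hpass : ∀ᶠ k in l, f^[k] (z k) = (resonantNormalForm lam A B)^[k] (z k) ∧
      fderiv ℝ (f^[k]) (z k) = fderiv ℝ ((resonantNormalForm lam A B)^[k]) (z k) :=
    hKl.mono fun k hk => iterate_eq_and_fderiv_iterate_eq hf (contDiff_resonantNormalForm hA hB)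
      hNc hNint hfN k fun j hj => ((hz k hk).2 j hj).1
  have hbase : Tendsto (fun k => |(z k).1| * |(q k).2|) l (𝓝 (|xs| * |ys|)) :=
    (((continuous_fst.tendsto _).comp hzlim).abs).mul (((continuous_snd.tendsto _).comp hqlim).abs)
  have H : SingleRoundPassage l lam A B (f^[m]) xs ys z q
      (fun k => μ ^ k * (|(z k).1| * |(q k).2|)) :=
    { le_atTop := hltop
      lam_ne := hlam
      lam_lt := hlam1
      smooth_A := hA
      smooth_B := hB
      smooth_F := hF
      tendsto_p := hzlim
      tendsto_q := hqlim
      map_q := hmapq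
      q_eq := hpass.mono fun k hk => hk.1
      bound := hKl.mono fun k hk j hj => (hz k hk).abs_iterate_resProduct_le hfN hlam hμ0 hrate hj
      tendsto_b := by
        have := ((tendsto_pow_atTop_nhds_zero_of_lt_one hμ0 hμ1).mono_left hltop).mul hbase
        rwa [zero_mul] at this
      tendsto_kb := by
        have := ((tendsto_self_mul_const_pow_of_lt_one hμ0 hμ1).mono_left hltop).mul hbase
        rw [zero_mul] at this
        exact this.congr fun k => by ring }
  have hD1 : (fderiv ℝ (f^[m]) (0, ys) (1, 0)).2 = ys / xs := by
    rw [← hd1, coeffD1]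
    exact (hasDerivAt_snd_mk_left hF 0 ys).deriv.symm
  have hD2 : (fderiv ℝ (f^[m]) (0, ys) (0, 1)).2 = 0 := by
    rw [coeffD2] at hd2
    exact (hasDerivAt_snd_mk_right hF 0 ys).deriv.symm.trans hd2
  have hsq := H.tendsto_scaledDev_sq hxs.ne' hhom hD1 hD2 hd5
  change Tendsto _ l (𝓝 (-((A 0 + B 0) * xs * ys ^ 2) / coeffD5 f m ys)) at hsq
  have hmain : A 0 + B 0 ≠ 0 →
      ∃ ζ : ℝ, ζ ≠ 0 ∧ coeffD5 f m ys * ζ ^ 2 = -((A 0 + B 0) * xs * ys ^ 2) ∧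
        Tendsto (fun k : ℕ => |returnTrace f m k (z k)| / √(k : ℝ)) l
          (𝓝 |2 * coeffD5 f m ys * ζ|) := by
    intro hab
    set c := -((A 0 + B 0) * xs * ys ^ 2) / coeffD5 f m ys with hc
    -- Being a limit of squares, `c` has the right sign for a real `ζ`; existence of the solutions
    -- enforces this.
    have hc0 : 0 ≤ c := ge_of_tendsto' hsq fun k => sq_nonneg _
    have hcne : c ≠ 0 := div_ne_zero
      (neg_ne_zero.2 (mul_ne_zero (mul_ne_zero hab hxs.ne') (pow_ne_zero 2 hys.ne'))) hd5
    have hζ : √c ^ 2 = c := Real.sq_sqrt hc0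
    refine ⟨√c, (Real.sqrt_ne_zero hc0).2 hcne, ?_, ?_⟩
    · rw [hζ, hc]
      field_simp
    · rw [← hζ] at hsq
      refine (H.tendsto_abs_trace_div (c := 2 * coeffD5 f m ys) hsq
        (by rw [coeffD5]; ring) hD2).congr' ?_
      filter_upwards [hKl, hpass] with k hk hp
      rw [(hz k hk).returnTrace_eq hf, hp.2]
  refine ⟨fun hstab => ?_, hmain⟩
  by_contra hab
  obtain ⟨ζ, hζ, -, hlim⟩ := hmain hab
  have hpos : 0 < |2 * coeffD5 f m ys * ζ| :=
    abs_pos.2 (mul_ne_zero (mul_ne_zero two_ne_zero hd5) hζ)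
  have htr := hlim.pos_mul_atTop hpos H.tendsto_sqrt_atTop
  have hdet := ((H.tendsto_entryDet_global.mul H.tendsto_entryDet_passage).abs).add_const 3
  -- The determinant converges while the trace tends to infinity in modulus, so a single large `k`
  -- in `K` contradicts stability.
  obtain ⟨k, ⟨⟨hk, hp⟩, hdk, htk⟩, hs⟩ := ((((hKl.and hpass).and
    ((hdet.eventually (ge_mem_nhds (lt_add_one _))).and (htr.eventually_ge_atTop _))).and
    (H.tendsto_sqrt_atTop.eventually_gt_atTop 0)).exists)
  rw [div_mul_cancel₀ _ hs.ne'] at htk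
  refine (hz k hk).not_isLyapunovStable hf ?_ (hstab k hk)
  rw [hp.2]
  exact hdk.trans htk
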